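/- \textbf{Theorem (minimax lower bound for the jump rate of a PDMP).} Let $x_0\ge 0$, and let the following be known. \emph{Flow.} $\phi:[0,\infty)\times[0,\infty)\to[0,\infty)$ is $\mathcal C^1$, $\phi(\cdot,t)$ is a homeomorphism onto its image for each $t\ge0$, $\phi(x,t+s)=\phi(\phi(x,s),t)$, and for $x>0$ and for $x=x_0$ the map $\phi_x=\phi(x,\cdot)$ is a $\mathcal C^1$-diffeomorphism from $[0,\infty)$ onto $[x,\infty)$. \emph{Jump map.} $f:[0,\infty)\to[0,\infty)$ is an increasing $\mathcal C^1$-diffeomorphism and $0<f(x)\le\kappa x$ for all $x>0$, where $0<\kappa<1$. \emph{Bounds.} With $g_x=[(f\circ\phi_x)^{-1}]'$ on $[f(x),\infty)$, there are continuous functions $\mathbf m,\mathbf M:(0,\infty)\to(0,\infty)$, $\mathbf m\le\mathbf M$, with $\mathbf m(y)\le g_x(y)\le\mathbf M(y)$ for all $y>0$ with $y\ge f(x)$ and all $x\in(0,\infty)\cup\{x_0\}$. For a jump rate $\lambda:[0,\infty)\to[0,\infty)$ the chain $(Z_k)$ is defined by $Z_0=x_0$ and $Z_{k+1}=f(\phi(Z_k,\tau_k))$,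 where, given the past, the inter-jump time $\tau_k$ has survival function $\mathbb P(\tau_k>t)=\exp\big(-\int_0^t\lambda(\phi(Z_k,s))\,ds\big)$. Let $\mathcal I=[i_1,i_2]$ with $0<i_1<i_2$, and let $b,L,\mathbf a,\varepsilon,\alpha,M_1>0$ and $r>i_2$ satisfy $r\ge f^{-1}\Big(\big[\tfrac{-\ln(1-\kappa^{b+1})}{1-\kappa^{b+1}}\big]^{1/(b+1)}\Big)$. Let $\mathcal E(\bar{\mathfrak c},b)$, $\bar{\mathfrak c}=(r,L,\mathbf a,\varepsilon)$, be the set of continuous $\lambda:[0,\infty)\to[0,\infty)$ such that $\frac{f(x)^b}{\mathbf m(f(x))}\le\frac{\lambda(x)}{\mathbf a}$ for all $x\ge r$, $\int_0^{f(r)}\mathbf M(u)\lambda(f^{-1}(u))\,du\le L$, and $\lambda(x)\ge\varepsilon$ for all $x\in[i_1,r]$. Let $H^\alpha(\mathcal I,M_1)$ be the set of functions that are $\mathcal C^{\mathbf r}$ on $\mathcal I$, $\mathbf r=\lfloor\alpha\rfloor$, with $\sup_{t>0}t^{\mathbf r-\alpha}\sup_{x,y\in\mathcal I,|x-y|\le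 t}|\lambda^{(\mathbf r)}(x)-\lambda^{(\mathbf r)}(y)|+\sup_{\mathcal I}|\lambda|\le M_1$. Assume the class is non-degenerate: $\varepsilon<M_1$ and $\varepsilon\int_{f(i_1)}^{f(r)}\mathbf M(u)\,du<L$. Then there is a constant $C>0$, not depending on $n$, such that for all $n\ge1$ \[\inf_{\hat\lambda_n}\ \sup_{\lambda\in\mathcal E(\bar{\mathfrak c},b)\cap H^\alpha(\mathcal I,M_1)}\mathbb E_\lambda\big[\|\hat\lambda_n-\lambda\|_{L^2(\mathcal I)}^2\big]\ \ge\ C\,n^{-2\alpha/(2\alpha+1)},\] where the infimum is over all estimators, that is, all jointly measurable functions $\hat\lambda_n=\hat\lambda_n(Z_0,\dots,Z_n;x)$. -/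

import Mathlib

open Set MeasureTheory
open scoped ENNReal

noncomputable section

namespace PDMP

/-- `h` is a `C¹`-diffeomorphism from `S` onto `T`. -/
structure IsC1Diffeo (h : ℝ → ℝ) (S T : Set ℝ) : Prop where
  bijOn : BijOn h S T
  contDiffOn : ContDiffOn ℝ 1 h S
  contDiffOn_inv : ContDiffOn ℝ 1 (Function.invFunOn h S) T

/-- The inverse of an increasing bijection `f` of `[0,∞)`. -/
def inv (f : ℝ → ℝ) : ℝ → ℝ := Function.invFunOn f (Ici 0)

/-- `φ` is a `C¹` flow on `[0,∞)` whose trajectories from the initial point `x₀` and from all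
points of `(0,∞)` are `C¹`-diffeomorphisms from `[0,∞)` onto `[x,∞)`.  (The origin is exempted
unless it is the initial point, since it can be a rest point, as for `φ(x,t) = x e^{ct}`.)
Functions on `[0,∞)` are represented by functions on `ℝ` of which only the restriction to `[0,∞)`
matters. -/
structure IsFlow (φ : ℝ → ℝ → ℝ) (x₀ : ℝ) : Prop where
  nonneg : ∀ x, 0 ≤ x → ∀ t, 0 ≤ t → 0 ≤ φ x t
  contDiffOn : ContDiffOn ℝ 1 (fun p : ℝ × ℝ => φ p.1 p.2) (Ici 0 ×ˢ Ici 0)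
  isEmbedding : ∀ t, 0 ≤ t → Topology.IsEmbedding ((Ici (0 : ℝ)).domRestrict fun x => φ x t)
  semigroup : ∀ x, 0 ≤ x → ∀ s, 0 ≤ s → ∀ t, 0 ≤ t → φ x (t + s) = φ (φ x s) t
  diffeo : ∀ x ∈ insert x₀ (Ioi (0 : ℝ)), IsC1Diffeo (φ x) (Ici 0) (Ici x)

/-- The jump map `f` is an increasing `C¹`-diffeomorphism of `[0,∞)` with `0 < f(x) ≤ κ x`. -/
structure IsJumpMap (f : ℝ → ℝ) (κ : ℝ) : Prop where
  diffeo : IsC1Diffeo f (Ici 0) (Ici 0)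
  strictMonoOn : StrictMonoOn f (Ici 0)
  bounds : ∀ x, 0 < x → 0 < f x ∧ f x ≤ κ * x

/-- `g_x(y)`, the derivative at `y ≥ f(x)` of the inverse of `t ↦ f(φ(x,t))`. -/
def g (φ : ℝ → ℝ → ℝ) (f : ℝ → ℝ) (x y : ℝ) : ℝ :=
  derivWithin (Function.invFunOn (fun t => f (φ x t)) (Ici 0)) (Ici (f x)) y

/-- `m` and `M` are continuous positive functions with `m(y) ≤ g_x(y) ≤ M(y)` wherever `g_x(y)`
is defined. -/
structure IsBound (φ : ℝ → ℝ → ℝ) (f : ℝ → ℝ) (x₀ : ℝ) (m M : ℝ → ℝ) : Prop where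
  continuousOn_lower : ContinuousOn m (Ioi 0)
  continuousOn_upper : ContinuousOn M (Ioi 0)
  pos : ∀ y, 0 < y → 0 < m y
  le : ∀ y, 0 < y → m y ≤ M y
  g_bounds : ∀ x ∈ insert x₀ (Ioi (0 : ℝ)), ∀ y, 0 < y → f x ≤ y →
    m y ≤ g φ f x y ∧ g φ f x y ≤ M y

/-- The class `𝓕((r, L, a), b)` of jump rates. -/
structure MemF (f m M : ℝ → ℝ) (r L a b : ℝ) (lam : ℝ → ℝ) : Prop where
  continuousOn : ContinuousOn lam (Ici 0)
  nonneg : ∀ x, 0 ≤ x → 0 ≤ lam x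
  tail : ∀ x, r ≤ x → (f x) ^ b / m (f x) ≤ lam x / a
  integral_le :
    ∫⁻ u in Ioc 0 (f r), ENNReal.ofReal (M u * lam (inv f u)) ≤ ENNReal.ofReal L

/-- The class `𝓔((r, L, a, ε), b)` of jump rates, for the estimation interval with left
endpoint `i₁`. -/
structure MemE (f m M : ℝ → ℝ) (r L a ε b i₁ : ℝ) (lam : ℝ → ℝ) : Prop
    extends MemF f m M r L a b lam where
  lower : ∀ x ∈ Icc i₁ r, ε ≤ lam x

/-- The modulus of continuity of `h` on `I`. -/
def modulus (I : Set ℝ) (h : ℝ → ℝ) (t : ℝ) : ℝ≥0∞ :=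
  ⨆ (x ∈ I) (y ∈ I) (_ : |x - y| ≤ t), ENNReal.ofReal |h x - h y|

/-- The Hölder norm
`sup_{t>0} t^{⌊α⌋-α} ω(h^{(⌊α⌋)}, t) + sup |h|` on `I`. -/
def holderNorm (α : ℝ) (I : Set ℝ) (h : ℝ → ℝ) : ℝ≥0∞ :=
  (⨆ (t : ℝ) (_ : 0 < t), ENNReal.ofReal (t ^ ((⌊α⌋₊ : ℝ) - α)) *
      modulus I (iteratedDerivWithin ⌊α⌋₊ h I) t) +
    ⨆ x ∈ I, ENNReal.ofReal |h x|

/-- The Hölder ball `H^α(I, R)`. -/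
def holderBall (α : ℝ) (I : Set ℝ) (R : ℝ) : Set (ℝ → ℝ) :=
  {h | ContDiffOn ℝ (⌊α⌋₊ : ℕ) h I ∧ holderNorm α I h ≤ ENNReal.ofReal R}

/-- The density at `t` of the time to the next jump from the point `x`, that is, of the law on
`[0,∞)` with survival function `t ↦ exp(-∫₀ᵗ λ(φ(x,s)) ds)`. -/
def jumpTimeDensity (φ : ℝ → ℝ → ℝ) (lam : ℝ → ℝ) (x t : ℝ) : ℝ≥0∞ :=
  if 0 ≤ t then ENNReal.ofReal (lam (φ x t) * Real.exp (-∫ s in (0 : ℝ)..t, lam (φ x s))) else 0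

/-- The post-jump positions `Z₀, …, Zₙ` as functions of the inter-jump times
`τ₀ = T₁ - T₀, …, τₙ₋₁ = Tₙ - Tₙ₋₁`: `Z₀ = x₀` and `Zₖ₊₁ = f(φ(Zₖ, τₖ))`. -/
def Z (φ : ℝ → ℝ → ℝ) (f : ℝ → ℝ) (x₀ : ℝ) {n : ℕ} (τ : Fin n → ℝ) : Fin (n + 1) → ℝ :=
  Fin.induction x₀ fun k z => f (φ z (τ k))

/-- The law of the first `n` inter-jump times of the process with jump rate `lam` started at
`x₀`: given the past, the next inter-jump time has density `jumpTimeDensity φ lam Zₖ`. -/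
def law (φ : ℝ → ℝ → ℝ) (f : ℝ → ℝ) (x₀ : ℝ) (lam : ℝ → ℝ) (n : ℕ) : Measure (Fin n → ℝ) :=
  (volume : Measure (Fin n → ℝ)).withDensity fun τ =>
    ∏ k : Fin n, jumpTimeDensity φ lam (Z φ f x₀ τ k.castSucc) (τ k)

/-- The squared `L²(I)` risk at `lam` of the estimator `est` built from `Z₀, …, Zₙ`. -/
def risk (φ : ℝ → ℝ → ℝ) (f : ℝ → ℝ) (x₀ : ℝ) (I : Set ℝ) (lam : ℝ → ℝ) {n : ℕ}
    (est : (Fin (n + 1) → ℝ) → ℝ → ℝ) : ℝ≥0∞ :=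
  ∫⁻ τ, (∫⁻ x in I, ENNReal.ofReal ((est (Z φ f x₀ τ) x - lam x) ^ 2)) ∂(law φ f x₀ lam n)

end PDMP

end

/-! The bound comes from Assouad's lemma. Cut the estimation interval into `m` cells of length `h`.
Start from one base rate equal to `ε` on the interval (`exists_base_rate`) and add on each cell
either nothing or a bump of height `d = A h ^ α`. The bumps do not overlap, and height `h ^ α` at
scale `h` keeps the Hölder seminorm of order `α` bounded independently of `h`, so all `2 ^ m` rates
stay in the class (`exists_mem_holderBall`).

Rates that differ on a single cell are hard to tell apart. From every state the flow spends time at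
most `K h` in the cell (`IsBound.exists_volume_le`), so the two laws of the next jump time have
Hellinger affinity at least `1 - O(d² h)` (`one_le_lintegral_affinity`). This is uniform in the
state, so the bounds multiply along the chain and no ergodicity is needed. After `n` jumps the
affinity is still at least `1/2` if `n d² h`, of order `n h ^ (2α + 1)`, is small
(`half_le_lintegral_affinity`). Estimators depend on the inter-jump times through the chain, so it
is enough to compare the laws of these times.

Hence on each cell the losses under the two rates add up to order `d² h` at least
(`two_point_bound`). Summing over the cells (`assouad`) gives a risk of order `m d² h`, that is `h ^
(2α)`, and `h` of order `n ^ (-1 / (2α + 1))` yields the rate. -/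

noncomputable section

namespace PDMP

/-! ### Path integrals along the chain. -/

section Chain

variable {φ : ℝ → ℝ → ℝ} {f : ℝ → ℝ}

theorem Z_zero (x : ℝ) {n : ℕ} (τ : Fin n → ℝ) : Z φ f x τ 0 = x := rfl

theorem Z_succ (x : ℝ) {n : ℕ} (τ : Fin n → ℝ) (k : Fin n) :
    Z φ f x τ k.succ = f (φ (Z φ f x τ k.castSucc) (τ k)) :=
  Fin.induction_succ (motive := fun _ => ℝ) _ _ _

theorem Z_cons_succ (x t : ℝ) {n : ℕ} (τ : Fin n → ℝ) (k : Fin (n + 1)) :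
    Z φ f x (Fin.cons t τ : Fin (n + 1) → ℝ) k.succ = Z φ f (f (φ x t)) τ k := by
  induction k using Fin.induction with
  | zero => rw [Z_succ]; simp [Z_zero]
  | succ k ih =>
    rw [Z_succ, Z_succ, ← ih]
    simp

theorem measurable_Z (hφ : Measurable (Function.uncurry φ)) (hf : Measurable f) (x : ℝ) {n : ℕ}
    (k : Fin (n + 1)) : Measurable fun τ : Fin n → ℝ => Z φ f x τ k := by
  induction k using Fin.induction with
  | zero => simp only [Z_zero]; exact measurable_const
  | succ k ih =>
    simp only [Z_succ]
    exact hf.comp (hφ.comp (ih.prodMk (measurable_pi_apply k)))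

/-- The product of the one-step weights `w` along the chain started at `x`. -/
def pathWeight (φ : ℝ → ℝ → ℝ) (f : ℝ → ℝ) (w : ℝ → ℝ → ℝ≥0∞) (x : ℝ) {n : ℕ}
    (τ : Fin n → ℝ) : ℝ≥0∞ :=
  ∏ k : Fin n, w (Z φ f x τ k.castSucc) (τ k)

theorem pathWeight_cons (w : ℝ → ℝ → ℝ≥0∞) (x t : ℝ) {n : ℕ} (τ : Fin n → ℝ) :
    pathWeight φ f w x (Fin.cons t τ : Fin (n + 1) → ℝ) =
      w x t * pathWeight φ f w (f (φ x t)) τ := by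
  simp only [pathWeight, Fin.prod_univ_succ, Fin.cons_zero, Fin.cons_succ, Fin.castSucc_zero,
    Z_zero, ← Fin.succ_castSucc, Z_cons_succ]

theorem measurable_pathWeight (hφ : Measurable (Function.uncurry φ)) (hf : Measurable f)
    {w : ℝ → ℝ → ℝ≥0∞} (hw : Measurable (Function.uncurry w)) (x : ℝ) (n : ℕ) :
    Measurable fun τ : Fin n → ℝ => pathWeight φ f w x τ :=
  Finset.measurable_prod _ fun k _ =>
    hw.comp ((measurable_Z hφ hf x k.castSucc).prodMk (measurable_pi_apply k))

/-- Markov property at the first jump: Fubini splits off the first time, and the chain restarts from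
its first post-jump position. -/
theorem lintegral_pathWeight_succ (hφ : Measurable (Function.uncurry φ)) (hf : Measurable f)
    {w : ℝ → ℝ → ℝ≥0∞} (hw : Measurable (Function.uncurry w)) (x : ℝ) (n : ℕ) :
    ∫⁻ τ : Fin (n + 1) → ℝ, pathWeight φ f w x τ =
      ∫⁻ t, w x t * ∫⁻ τ : Fin n → ℝ, pathWeight φ f w (f (φ x t)) τ := by
  have e := (volume_preserving_piFinSuccAbove (fun _ : Fin (n + 1) => ℝ) 0).symm
  have hm := measurable_pathWeight hφ hf hw x (n + 1)
  rw [← e.lintegral_comp hm, Measure.volume_eq_prod]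
  refine (lintegral_prod _ (hm.comp e.measurable).aemeasurable).trans ?_
  refine lintegral_congr fun t => ?_
  rw [← lintegral_const_mul _ (measurable_pathWeight hφ hf hw _ n)]
  refine lintegral_congr fun τ => ?_
  rw [← pathWeight_cons]
  exact congrArg (pathWeight φ f w x) (Fin.insertNth_zero' t τ)

/-- Induction on the first jump. The one-step bound is uniform over a set `S` that the chain never
leaves, so it multiplies. It serves to tensorize the affinity. -/
theorem pow_le_lintegral_pathWeight (hφ : Measurable (Function.uncurry φ)) (hf : Measurable f)
    {w : ℝ → ℝ → ℝ≥0∞} (hw : Measurable (Function.uncurry w)) (hw₀ : ∀ x t, t < 0 → w x t = 0)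
    {S : Set ℝ} (hS : ∀ x ∈ S, ∀ t, 0 ≤ t → f (φ x t) ∈ S) {c : ℝ≥0∞}
    (hc : ∀ x ∈ S, c ≤ ∫⁻ t, w x t) (n : ℕ) {x : ℝ} (hx : x ∈ S) :
    c ^ n ≤ ∫⁻ τ : Fin n → ℝ, pathWeight φ f w x τ := by
  induction n generalizing x with
  | zero => simp [pathWeight, volume_pi]
  | succ n ih =>
    rw [lintegral_pathWeight_succ hφ hf hw, pow_succ']
    calc c * c ^ n ≤ (∫⁻ t, w x t) * c ^ n := by gcongr; exact hc x hx
      _ = ∫⁻ t, w x t * c ^ n := (lintegral_mul_const _ hw.of_uncurry_left).symm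
      _ ≤ _ := lintegral_mono fun t => by
        rcases lt_or_ge t 0 with ht | ht
        · simp [hw₀ x t ht]
        · dsimp only; gcongr; exact ih (hS x hx t ht)

theorem lintegral_pathWeight_le_one (hφ : Measurable (Function.uncurry φ)) (hf : Measurable f)
    {w : ℝ → ℝ → ℝ≥0∞} (hw : Measurable (Function.uncurry w)) (hw₀ : ∀ x t, t < 0 → w x t = 0)
    {S : Set ℝ} (hS : ∀ x ∈ S, ∀ t, 0 ≤ t → f (φ x t) ∈ S)
    (hc : ∀ x ∈ S, ∫⁻ t, w x t ≤ 1) (n : ℕ) {x : ℝ} (hx : x ∈ S) :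
    ∫⁻ τ : Fin n → ℝ, pathWeight φ f w x τ ≤ 1 := by
  induction n generalizing x with
  | zero => simp [pathWeight, volume_pi]
  | succ n ih =>
    rw [lintegral_pathWeight_succ hφ hf hw]
    refine (lintegral_mono fun t => ?_).trans (hc x hx)
    rcases lt_or_ge t 0 with ht | ht
    · simp [hw₀ x t ht]
    · exact mul_le_of_le_one_right' (ih (hS x hx t ht))

end Chain

/-! ### Two-point testing and Assouad's lemma. -/

section Testing

/-- For `a ≤ b` this is the AM-GM inequality `a + b / 16 ≥ 2 √(a b / 16) = w / 2`. -/
theorem half_le_min_add {a b w : ℝ≥0∞} (h : w ^ 2 = a * b) :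
    w / 2 ≤ min a b + (a + b) / 16 := by
  wlog hab : a ≤ b generalizing a b
  · rw [min_comm, add_comm a b]
    exact this (by rw [h, mul_comm]) (le_of_not_ge hab)
  rw [min_eq_left hab]
  by_cases hb : b = ∞
  · simp [hb, ENNReal.top_div_of_ne_top]
  have ha : a ≠ ∞ := ne_top_of_le_ne_top hb hab
  have hw : w ≠ ∞ := fun hw => by
    rw [hw] at h
    exact ENNReal.mul_ne_top ha hb (by rw [← h]; simp)
  lift a to NNReal using ha
  lift b to NNReal using hb
  lift w to NNReal using hw
  have h' : (w : ℝ) ^ 2 = a * b := by exact_mod_cast h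
  have : (w : ℝ) / 2 ≤ a + (a + b) / 16 := by
    have ha := a.2
    have hb := b.2
    change 0 ≤ (a : ℝ) at ha
    change 0 ≤ (b : ℝ) at hb
    refine abs_le_of_sq_le_sq' ?_ (by positivity) |>.2
    nlinarith [sq_nonneg ((a : ℝ) - b / 16), mul_nonneg ha hb, mul_nonneg ha ha]
  have h2 : w / 2 ≤ a + (a + b) / 16 := by exact_mod_cast this
  have h3 : ((w / 2 : NNReal) : ℝ≥0∞) ≤ ((a + (a + b) / 16 : NNReal) : ℝ≥0∞) := by
    exact_mod_cast h2
  simpa [ENNReal.coe_div] using h3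

variable {Ω : Type*} [MeasurableSpace Ω] {μ : Measure Ω} {P Q W : Ω → ℝ≥0∞}

/-- Le Cam's bound of testing affinity by Hellinger affinity. Integrating `half_le_min_add` gives
`1/4` on the left, and the error term costs at most `(1 + 1) / 16 = 1/8`. -/
theorem eighth_le_lintegral_min (hP : Measurable P) (hQ : Measurable Q)
    (hW : ∀ ω, W ω ^ 2 = P ω * Q ω) (hP₁ : ∫⁻ ω, P ω ∂μ ≤ 1) (hQ₁ : ∫⁻ ω, Q ω ∂μ ≤ 1)
    (hW₁ : 1 / 2 ≤ ∫⁻ ω, W ω ∂μ) : 1 / 8 ≤ ∫⁻ ω, min (P ω) (Q ω) ∂μ := by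
  have h : (∫⁻ ω, W ω ∂μ) / 2 ≤ (∫⁻ ω, min (P ω) (Q ω) ∂μ) + 1 / 8 := by
    calc (∫⁻ ω, W ω ∂μ) / 2 ≤ ∫⁻ ω, W ω / 2 ∂μ := by
          simp only [div_eq_mul_inv]
          rw [lintegral_mul_const' _ _ (by simp)]
      _ ≤ ∫⁻ ω, (min (P ω) (Q ω) + (P ω + Q ω) / 16) ∂μ :=
        lintegral_mono fun ω => half_le_min_add (hW ω)
      _ = (∫⁻ ω, min (P ω) (Q ω) ∂μ) + (∫⁻ ω, P ω ∂μ + ∫⁻ ω, Q ω ∂μ) / 16 := by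
        rw [lintegral_add_left (hP.min hQ)]
        simp only [div_eq_mul_inv]
        rw [lintegral_mul_const' _ _ (by simp), lintegral_add_left hP]
      _ ≤ (∫⁻ ω, min (P ω) (Q ω) ∂μ) + (1 + 1) / 16 := by gcongr
      _ = _ := by
        congr 1
        rw [ENNReal.div_eq_div_iff] <;> norm_num
  have h4 : (1 / 8 : ℝ≥0∞) + 1 / 8 ≤ (∫⁻ ω, W ω ∂μ) / 2 := by
    calc (1 / 8 : ℝ≥0∞) + 1 / 8 = 1 / 2 / 2 := by
          rw [← ENNReal.add_div, ← ENNReal.toReal_eq_toReal_iff']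
          · norm_num [ENNReal.toReal_div]
          · exact ENNReal.div_ne_top (by norm_num) (by norm_num)
          · exact ENNReal.div_ne_top (ENNReal.div_ne_top (by norm_num) (by norm_num)) (by norm_num)
      _ ≤ _ := by gcongr
  exact (ENNReal.add_le_add_iff_right (by simp)).1 (h4.trans h)

/-- Both laws dominate their minimum, under which the losses `A` and `B` are paid together. -/
theorem two_point_bound (hP : Measurable P) (hQ : Measurable Q)
    (hW : ∀ ω, W ω ^ 2 = P ω * Q ω) (hP₁ : ∫⁻ ω, P ω ∂μ ≤ 1) (hQ₁ : ∫⁻ ω, Q ω ∂μ ≤ 1)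
    (hW₁ : 1 / 2 ≤ ∫⁻ ω, W ω ∂μ) {A B : Ω → ℝ≥0∞} (hA : Measurable A) {D : ℝ≥0∞}
    (hD : ∀ ω, D ≤ A ω + B ω) :
    D / 8 ≤ (∫⁻ ω, P ω * A ω ∂μ) + ∫⁻ ω, Q ω * B ω ∂μ := by
  rw [← lintegral_add_left (by exact hP.mul hA)]
  calc D / 8 = 1 / 8 * D := by rw [div_eq_mul_inv, one_div, mul_comm]
    _ ≤ (∫⁻ ω, min (P ω) (Q ω) ∂μ) * D := by
      gcongr
      exact eighth_le_lintegral_min hP hQ hW hP₁ hQ₁ hW₁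
    _ = ∫⁻ ω, min (P ω) (Q ω) * D ∂μ := (lintegral_mul_const _ (hP.min hQ)).symm
    _ ≤ _ := lintegral_mono fun ω => by
      calc min (P ω) (Q ω) * D ≤ min (P ω) (Q ω) * (A ω + B ω) := by gcongr; exact hD ω
        _ ≤ P ω * A ω + Q ω * B ω := by
          rw [mul_add]
          gcongr
          · exact min_le_left _ _
          · exact min_le_right _ _

/-- Assouad's lemma in additive form. -/
theorem assouad {m : ℕ} {R : (Fin m → Bool) → ℝ≥0∞} {ρ : (Fin m → Bool) → Fin m → ℝ≥0∞}
    (hR : ∀ θ, ∑ k, ρ θ k ≤ R θ) {D : ℝ≥0∞}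
    (hρ : ∀ θ k, D ≤ ρ θ k + ρ (Function.update θ k (!θ k)) k) {s : ℝ≥0∞} (hs : ∀ θ, R θ ≤ s) :
    m * D ≤ 2 * s := by
  -- Flipping one coordinate permutes the hypercube, so the flipped terms have the same total as the
  -- unflipped ones.
  have hinv : ∀ k : Fin m, Function.Involutive fun θ : Fin m → Bool =>
      Function.update θ k (!θ k) := fun k θ => by simp
  have h1 : ∀ k, (2 ^ m : ℝ≥0∞) * D ≤ 2 * ∑ θ, ρ θ k := fun k => by
    calc (2 ^ m : ℝ≥0∞) * D = ∑ _θ : Fin m → Bool, D := by simp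
      _ ≤ ∑ θ, (ρ θ k + ρ (Function.update θ k (!θ k)) k) :=
        Finset.sum_le_sum fun θ _ => hρ θ k
      _ = 2 * ∑ θ, ρ θ k := by
        rw [Finset.sum_add_distrib, two_mul]
        congr 1
        exact Equiv.sum_comp (hinv k).toPerm (fun θ => ρ θ k)
  have h2 : (2 ^ m : ℝ≥0∞) * (m * D) ≤ 2 ^ m * (2 * s) := by
    calc (2 ^ m : ℝ≥0∞) * (m * D) = ∑ _k : Fin m, 2 ^ m * D := by
          simp [mul_left_comm]
      _ ≤ ∑ k, 2 * ∑ θ, ρ θ k := Finset.sum_le_sum fun k _ => h1 k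
      _ = 2 * ∑ θ, ∑ k, ρ θ k := by rw [← Finset.mul_sum, Finset.sum_comm]
      _ ≤ 2 * ∑ _θ : Fin m → Bool, s := by
        gcongr with θ
        exact (hR θ).trans (hs θ)
      _ = 2 ^ m * (2 * s) := by simp [mul_left_comm]
  exact (ENNReal.mul_le_mul_iff_right (by positivity) (by simp)).1 h2

end Testing

/-! ### Occupation times of the flow. -/

section Flow

open Filter Topology

variable {φ : ℝ → ℝ → ℝ} {f : ℝ → ℝ} {x₀ κ : ℝ} {m M : ℝ → ℝ}

/-- A continuous injection on an interval is strictly monotone. It cannot decrease here, because the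
image is unbounded above. -/
theorem IsC1Diffeo.strictMonoOn {h : ℝ → ℝ} {x : ℝ} (hh : IsC1Diffeo h (Ici 0) (Ici x)) :
    StrictMonoOn h (Ici 0) := by
  intro s hs t ht hst
  obtain ⟨B, hB⟩ := (isCompact_Icc (a := (0 : ℝ)) (b := t)).bddAbove_image
    (hh.contDiffOn.continuousOn.mono Icc_subset_Ici_self)
  have h0 : h 0 ≤ B := hB ⟨0, ⟨le_rfl, ht⟩, rfl⟩
  have hx0 : x ≤ h 0 := hh.bijOn.mapsTo self_mem_Ici
  obtain ⟨u, hu, hub⟩ := hh.bijOn.surjOn (show B + 1 ∈ Ici x by simp only [mem_Ici]; linarith)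
  have htu : t < u := by
    by_contra! hut
    have := hB ⟨u, ⟨hu, hut⟩, rfl⟩
    linarith
  exact ContinuousOn.strictMonoOn_of_injOn_Icc hu (by linarith)
    (hh.contDiffOn.continuousOn.mono Icc_subset_Ici_self)
    (hh.bijOn.injOn.mono Icc_subset_Ici_self) ⟨hs, by linarith⟩ ⟨ht, htu.le⟩ hst

theorem IsJumpMap.map_zero (hf : IsJumpMap f κ) : f 0 = 0 := by
  obtain ⟨t, ht, h⟩ := hf.diffeo.bijOn.surjOn (self_mem_Ici (a := (0 : ℝ)))
  exact le_antisymm (h ▸ hf.strictMonoOn.monotoneOn self_mem_Ici ht ht)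
    (hf.diffeo.bijOn.mapsTo self_mem_Ici)

theorem nonneg_of_mem_states (hx₀ : 0 ≤ x₀) {x : ℝ} (hx : x ∈ insert x₀ (Ioi (0 : ℝ))) :
    0 ≤ x := by
  rcases hx with rfl | hx
  exacts [hx₀, le_of_lt hx]

/-- The chain can sit at the origin only if it started there: trajectories do not decrease and `f`
is positive on positive points. -/
theorem IsFlow.jump_mem_states (hφ : IsFlow φ x₀) (hf : IsJumpMap f κ) (hx₀ : 0 ≤ x₀) {x : ℝ}
    (hx : x ∈ insert x₀ (Ioi (0 : ℝ))) {t : ℝ} (ht : 0 ≤ t) :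
    f (φ x t) ∈ insert x₀ (Ioi (0 : ℝ)) := by
  have hxt : x ≤ φ x t := (hφ.diffeo x hx).bijOn.mapsTo ht
  have hx' := nonneg_of_mem_states hx₀ hx
  rcases (hx'.trans hxt).eq_or_lt with h | h
  · rcases hx with rfl | hx
    · left
      rw [← h, hf.map_zero]
      exact le_antisymm hx₀ (hxt.trans h.ge)
    · exact absurd (h ▸ hxt) (not_le.2 hx)
  · exact Or.inr (hf.bounds _ h).1

/-- The time that a trajectory spends in an interval is at most a multiple of its length. -/
theorem IsBound.exists_volume_le (hφ : IsFlow φ x₀) (hf : IsJumpMap f κ)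
    (hmM : IsBound φ f x₀ m M) (hx₀ : 0 ≤ x₀) {i₁ i₂ : ℝ} (hi₁ : 0 < i₁) :
    ∃ K, 0 < K ∧ ∀ x ∈ insert x₀ (Ioi (0 : ℝ)), ∀ u v, i₁ ≤ u → u ≤ v → v ≤ i₂ →
      volume {t | 0 ≤ t ∧ φ x t ∈ Icc u v} ≤ ENNReal.ofReal (K * (v - u)) := by
  obtain ⟨B, hB⟩ := (isCompact_Icc (a := f i₁) (b := f i₂)).bddAbove_image
    (hmM.continuousOn_upper.mono fun y hy => (hf.bounds i₁ hi₁).1.trans_le hy.1)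
  obtain ⟨Λ, hΛ⟩ := (hf.diffeo.contDiffOn.mono (fun x hx => hi₁.le.trans hx.1 :
    Icc i₁ i₂ ⊆ Ici 0)).exists_lipschitzOnWith one_ne_zero (convex_Icc i₁ i₂) isCompact_Icc
  have hΛ0 : (0 : ℝ) ≤ Λ := Λ.2
  -- `B` bounds the derivative of the inverse of `t ↦ f (φ x t)` and `Λ` is a Lipschitz constant of
  -- `f`; the product bounds elapsed time per unit length. The `max` and the `+ 1` make it positive.
  refine ⟨max B 1 * (Λ + 1), by positivity, fun x hx u v hu huv hv => ?_⟩
  have hx' := nonneg_of_mem_states hx₀ hx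
  have hmono := hf.strictMonoOn.monotoneOn
  have hinj : InjOn (fun t => f (φ x t)) (Ici 0) := fun s hs t ht h =>
    (hφ.diffeo x hx).bijOn.injOn hs ht
      (hf.strictMonoOn.injOn (hφ.nonneg x hx' s hs) (hφ.nonneg x hx' t ht) h)
  set G := Function.invFunOn (fun t => f (φ x t)) (Ici 0) with hG
  have hGl : ∀ t, 0 ≤ t → G (f (φ x t)) = t := fun t ht => hinj.leftInvOn_invFunOn ht
  set T := Icc (max (f u) (f x)) (f v) with hT
  have hu0 : 0 < u := hi₁.trans_le hu
  have hTpos : ∀ y ∈ T, 0 < y := fun y hy =>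
    (hf.bounds u hu0).1.trans_le ((le_max_left _ _).trans hy.1)
  have hgb : ∀ y ∈ T, m y ≤ g φ f x y ∧ g φ f x y ≤ M y := fun y hy =>
    hmM.g_bounds x hx y (hTpos y hy) ((le_max_right _ _).trans hy.1)
  -- `derivWithin` is `0` where there is no derivative, so the positive lower bound `m` forces
  -- differentiability.
  have hder : ∀ y ∈ T, HasDerivWithinAt G (g φ f x y) T y := fun y hy =>
    ((differentiableWithinAt_of_derivWithin_ne_zero
      ((hmM.pos y (hTpos y hy)).trans_le (hgb y hy).1).ne').hasDerivWithinAt).mono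
      fun z hz => (le_max_right _ _).trans hz.1
  have hbound : ∀ y ∈ T, ‖g φ f x y‖ ≤ max B 1 := fun y hy => by
    rw [Real.norm_of_nonneg ((hmM.pos y (hTpos y hy)).le.trans (hgb y hy).1)]
    refine (hgb y hy).2.trans ((hB ⟨y, ⟨?_, ?_⟩, rfl⟩).trans (le_max_left _ _))
    · exact (hmono hi₁.le hu0.le hu).trans ((le_max_left _ _).trans hy.1)
    · exact hy.2.trans (hmono (hu0.le.trans huv) ((hu0.le.trans huv).trans hv) hv)
  refine (Real.volume_le_diam _).trans (Metric.ediam_le fun s hs t ht => ?_)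
  rw [edist_dist]
  refine ENNReal.ofReal_le_ofReal ?_
  have hmem : ∀ t, 0 ≤ t → φ x t ∈ Icc u v → f (φ x t) ∈ T := fun t ht h =>
    ⟨max_le (hmono hu0.le (hφ.nonneg x hx' t ht) h.1)
      (hmono hx' (hφ.nonneg x hx' t ht) ((hφ.diffeo x hx).bijOn.mapsTo ht)),
      hmono (hφ.nonneg x hx' t ht) (hu0.le.trans huv) h.2⟩
  have hI : Icc u v ⊆ Icc i₁ i₂ := Icc_subset_Icc hu hv
  have h1 := Convex.norm_image_sub_le_of_norm_hasDerivWithin_le hder hbound (convex_Icc _ _)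
    (hmem t ht.1 ht.2) (hmem s hs.1 hs.2)
  rw [hGl s hs.1, hGl t ht.1] at h1
  have h2 := hΛ.dist_le_mul _ (hI hs.2) _ (hI ht.2)
  have h3 := Real.dist_le_of_mem_Icc hs.2 ht.2
  calc dist s t ≤ max B 1 * dist (f (φ x s)) (f (φ x t)) := h1
    _ ≤ max B 1 * (Λ * (v - u)) := by
      gcongr
      exact h2.trans (by gcongr)
    _ ≤ max B 1 * (Λ + 1) * (v - u) := by
      rw [mul_assoc]
      gcongr
      · linarith

end Flow

/-! ### Hellinger affinity of one jump time. -/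

section OneStep

open Filter Topology

/-- The integrand is the derivative of `-exp (-∫ v)`, which rises from `-1` to `0` because the
cumulated hazard diverges. -/
theorem lintegral_hazard_eq_one {v : ℝ → ℝ} (hv : Continuous v) (hv₀ : ∀ t, 0 ≤ v t)
    (h : Tendsto (fun t => ∫ s in (0 : ℝ)..t, v s) atTop atTop) :
    ∫⁻ t, (if 0 ≤ t then ENNReal.ofReal (v t * Real.exp (-∫ s in (0 : ℝ)..t, v s)) else 0) = 1 := by
  have hd : ∀ t ∈ Ici (0 : ℝ), HasDerivAt (fun t => -Real.exp (-∫ s in (0 : ℝ)..t, v s))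
      (v t * Real.exp (-∫ s in (0 : ℝ)..t, v s)) t := fun t _ => by
    have := ((hv.integral_hasStrictDerivAt 0 t).hasDerivAt.neg.exp).neg
    exact this.congr_deriv (by simp [mul_comm])
  have hpos : ∀ t ∈ Ioi (0 : ℝ), 0 ≤ v t * Real.exp (-∫ s in (0 : ℝ)..t, v s) := fun t _ =>
    mul_nonneg (hv₀ t) (Real.exp_pos _).le
  have hlim : Tendsto (fun t => -Real.exp (-∫ s in (0 : ℝ)..t, v s)) atTop (𝓝 0) := by
    simpa using (Real.tendsto_exp_neg_atTop_nhds_zero.comp h).neg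
  have h1 := integral_Ioi_of_hasDerivAt_of_nonneg' hd hpos hlim
  have h2 := integrableOn_Ioi_deriv_of_nonneg' hd hpos hlim
  have h3 := ofReal_integral_eq_lintegral_ofReal h2
    ((ae_restrict_mem measurableSet_Ioi).mono hpos)
  rw [h1] at h3
  simp only [intervalIntegral.integral_same, neg_zero, Real.exp_zero, sub_neg_eq_add, zero_add,
    ENNReal.ofReal_one] at h3
  rw [h3, ← setLIntegral_congr Ioi_ae_eq_Ici.symm, ← lintegral_indicator measurableSet_Ici]
  rfl

/-- The left side is `(√p - √q)² / 2`, and `(p - q)² = (√p - √q)² (√p + √q)²` with `(√p + √q)² ≥ 4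
ε`. -/
theorem mean_sub_sqrt_le {p q ε : ℝ} (hε : 0 < ε) (hp : ε ≤ p) (hq : ε ≤ q) :
    (p + q) / 2 - √(p * q) ≤ (p - q) ^ 2 / (8 * ε) := by
  have hp0 : 0 ≤ p := hε.le.trans hp
  have hq0 : 0 ≤ q := hε.le.trans hq
  rw [Real.sqrt_mul hp0, le_div_iff₀ (by positivity)]
  have h1 := Real.sq_sqrt hp0
  have h2 := Real.sq_sqrt hq0
  have h3 : √ε ≤ √p := Real.sqrt_le_sqrt hp
  have h4 : √ε ≤ √q := Real.sqrt_le_sqrt hq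
  have h5 := Real.sq_sqrt hε.le
  have h6 := Real.sqrt_nonneg ε
  have h7 : 4 * ε ≤ (√p + √q) ^ 2 := by nlinarith
  have h8 : (p - q) ^ 2 = (√p - √q) ^ 2 * (√p + √q) ^ 2 := by
    rw [← mul_pow]; congr 1; nlinarith
  have h9 : (p + q) / 2 - √p * √q = (√p - √q) ^ 2 / 2 := by nlinarith
  rw [h8, h9]
  nlinarith [sq_nonneg (√p - √q)]

/-- Compare with the jump density of the averaged rate, which has mass one. It has the same
exponential factor, so the two integrands differ only where `v ≠ w`, and there by at most `c`. -/
theorem one_le_lintegral_affinity {v w : ℝ → ℝ} (hv : Continuous v) (hw : Continuous w)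
    (hv₀ : ∀ t, 0 ≤ v t) (hw₀ : ∀ t, 0 ≤ w t)
    (h : Tendsto (fun t => ∫ s in (0 : ℝ)..t, (v s + w s) / 2) atTop atTop) {c : ℝ} (hc₀ : 0 ≤ c)
    (hc : ∀ t, 0 ≤ t → v t ≠ w t → (v t + w t) / 2 - √(v t * w t) ≤ c) {V : ℝ≥0∞}
    (hV : volume {t | 0 ≤ t ∧ v t ≠ w t} ≤ V) :
    1 ≤ (∫⁻ t, (if 0 ≤ t then ENNReal.ofReal
      (√(v t * w t) * Real.exp (-∫ s in (0 : ℝ)..t, (v s + w s) / 2)) else 0)) +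
      ENNReal.ofReal c * V := by
  set N := {t | 0 ≤ t ∧ v t ≠ w t} with hN
  have hNm : MeasurableSet N := measurableSet_Ici.inter
    (measurableSet_eq_fun hv.measurable hw.measurable).compl
  rw [← lintegral_hazard_eq_one (v := fun t => (v t + w t) / 2) (by fun_prop)
    (fun t => by have := hv₀ t; have := hw₀ t; positivity) h]
  calc _ ≤ ∫⁻ t, ((if 0 ≤ t then ENNReal.ofReal
      (√(v t * w t) * Real.exp (-∫ s in (0 : ℝ)..t, (v s + w s) / 2)) else 0) +
      N.indicator (fun _ => ENNReal.ofReal c) t) := lintegral_mono fun t => ?_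
    _ = (∫⁻ t, (if 0 ≤ t then ENNReal.ofReal
      (√(v t * w t) * Real.exp (-∫ s in (0 : ℝ)..t, (v s + w s) / 2)) else 0)) +
      ENNReal.ofReal c * volume N := by
      rw [lintegral_add_right _ (measurable_const.indicator hNm), lintegral_indicator_const hNm]
    _ ≤ _ := by gcongr
  by_cases ht : 0 ≤ t
  · simp only [ht, if_true]
    have hE : 0 ≤ ∫ s in (0 : ℝ)..t, (v s + w s) / 2 :=
      intervalIntegral.integral_nonneg ht fun s _ => by
        have := hv₀ s; have := hw₀ s; positivity
    have he : Real.exp (-∫ s in (0 : ℝ)..t, (v s + w s) / 2) ≤ 1 :=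
      Real.exp_le_one_iff.2 (by linarith)
    have he0 := (Real.exp_pos (-∫ s in (0 : ℝ)..t, (v s + w s) / 2)).le
    by_cases hvw : v t = w t
    · rw [hvw, Real.sqrt_mul_self (hw₀ t), add_self_div_two]
      exact le_self_add
    · rw [indicator_of_mem (show t ∈ N from ⟨ht, hvw⟩), ← ENNReal.ofReal_add (by positivity) hc₀]
      refine ENNReal.ofReal_le_ofReal ?_
      have := hc t ht hvw
      nlinarith [mul_le_mul_of_nonneg_right this he0]
  · simp [ht]

/-- The square root of the product of the densities of the jump times with rates `lam`, `lam'`. -/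
def affinityDensity (φ : ℝ → ℝ → ℝ) (lam lam' : ℝ → ℝ) (x t : ℝ) : ℝ≥0∞ :=
  if 0 ≤ t then ENNReal.ofReal (√(lam (φ x t) * lam' (φ x t)) *
    Real.exp (-∫ s in (0 : ℝ)..t, (lam (φ x s) + lam' (φ x s)) / 2)) else 0

variable {φ : ℝ → ℝ → ℝ} {f lam lam' : ℝ → ℝ}

theorem affinityDensity_sq (hφ : Continuous (Function.uncurry φ)) (hl : Continuous lam)
    (hl' : Continuous lam') (h₀ : ∀ x, 0 ≤ lam x) (h₀' : ∀ x, 0 ≤ lam' x) (x t : ℝ) :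
    affinityDensity φ lam lam' x t ^ 2 =
      jumpTimeDensity φ lam x t * jumpTimeDensity φ lam' x t := by
  have hφx : Continuous (φ x) := hφ.comp (Continuous.prodMk_right x)
  unfold affinityDensity jumpTimeDensity
  split_ifs with ht
  · rw [← ENNReal.ofReal_pow (by positivity),
      ← ENNReal.ofReal_mul (mul_nonneg (h₀ _) (Real.exp_pos _).le), mul_pow,
      Real.sq_sqrt (mul_nonneg (h₀ _) (h₀' _)), ← Real.exp_nat_mul,
      intervalIntegral.integral_div, intervalIntegral.integral_add
        (f := fun s => lam (φ x s)) (g := fun s => lam' (φ x s))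
        ((hl.comp hφx).intervalIntegrable _ _) ((hl'.comp hφx).intervalIntegrable _ _),
      mul_mul_mul_comm, ← Real.exp_add]
    congr 3
    push_cast
    ring
  · simp

theorem continuous_integral_flow (hφ : Continuous (Function.uncurry φ)) (hl : Continuous lam) :
    Continuous fun p : ℝ × ℝ => ∫ s in (0 : ℝ)..p.2, lam (φ p.1 s) :=
  intervalIntegral.continuous_parametric_intervalIntegral_of_continuous
    (f := fun (p : ℝ × ℝ) s => lam (φ p.1 s))
    (hl.comp (hφ.comp (continuous_fst.fst.prodMk continuous_snd))) continuous_snd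

theorem measurable_jumpTimeDensity (hφ : Continuous (Function.uncurry φ)) (hl : Continuous lam) :
    Measurable (Function.uncurry (jumpTimeDensity φ lam)) := by
  refine Measurable.ite (measurableSet_le measurable_const measurable_snd)
    (ENNReal.measurable_ofReal.comp ?_) measurable_const
  exact ((hl.comp hφ).mul (continuous_integral_flow hφ hl).neg.rexp).measurable

theorem measurable_affinityDensity (hφ : Continuous (Function.uncurry φ)) (hl : Continuous lam)
    (hl' : Continuous lam') : Measurable (Function.uncurry (affinityDensity φ lam lam')) := by
  refine Measurable.ite (measurableSet_le measurable_const measurable_snd)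
    (ENNReal.measurable_ofReal.comp ?_) measurable_const
  exact (((hl.comp hφ).mul (hl'.comp hφ)).sqrt.mul
    (continuous_integral_flow (lam := fun x => (lam x + lam' x) / 2) hφ
      (by fun_prop)).neg.rexp).measurable

theorem jumpTimeDensity_of_neg {x t : ℝ} (ht : t < 0) : jumpTimeDensity φ lam x t = 0 :=
  if_neg (not_le.2 ht)

theorem affinityDensity_of_neg {x t : ℝ} (ht : t < 0) : affinityDensity φ lam lam' x t = 0 :=
  if_neg (not_le.2 ht)

theorem pathWeight_sq {n : ℕ} {w p q : ℝ → ℝ → ℝ≥0∞} (h : ∀ x t, w x t ^ 2 = p x t * q x t)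
    (x : ℝ) (τ : Fin n → ℝ) :
    pathWeight φ f w x τ ^ 2 = pathWeight φ f p x τ * pathWeight φ f q x τ := by
  simp only [pathWeight, ← Finset.prod_pow, h, Finset.prod_mul_distrib]

end OneStep

/-! ### Continuous extensions of the flow and the jump map, for measurability. -/

section Extension

variable {φ : ℝ → ℝ → ℝ} {f lam : ℝ → ℝ} {x₀ κ : ℝ}

/-- The continuous extension to the plane of a flow on `[0,∞)`. -/
def flowExt (φ : ℝ → ℝ → ℝ) (x t : ℝ) : ℝ := φ (max x 0) (max t 0)

/-- The continuous extension to the line of a function on `[0,∞)`. -/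
def jumpExt (f : ℝ → ℝ) (x : ℝ) : ℝ := f (max x 0)

theorem flowExt_eq {x t : ℝ} (hx : 0 ≤ x) (ht : 0 ≤ t) : flowExt φ x t = φ x t := by
  simp [flowExt, hx, ht]

theorem jumpExt_eq {x : ℝ} (hx : 0 ≤ x) : jumpExt f x = f x := by
  simp [jumpExt, hx]

theorem IsFlow.continuous_flowExt (hφ : IsFlow φ x₀) :
    Continuous (Function.uncurry (flowExt φ)) :=
  hφ.contDiffOn.continuousOn.comp_continuous
    (f := fun p : ℝ × ℝ => (max p.1 0, max p.2 0)) (by fun_prop)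
    fun p => ⟨le_max_right p.1 0, le_max_right p.2 0⟩

theorem IsJumpMap.continuous_jumpExt (hf : IsJumpMap f κ) : Continuous (jumpExt f) :=
  hf.diffeo.contDiffOn.continuousOn.comp_continuous (f := fun x : ℝ => max x 0) (by fun_prop)
    fun x => le_max_right x 0

theorem jumpTimeDensity_flowExt {x : ℝ} (hx : 0 ≤ x) (t : ℝ) :
    jumpTimeDensity (flowExt φ) lam x t = jumpTimeDensity φ lam x t := by
  unfold jumpTimeDensity
  split_ifs with ht
  · rw [flowExt_eq hx ht, intervalIntegral.integral_congr (g := fun s => lam (φ x s))]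
    intro s hs
    rw [uIcc_of_le ht] at hs
    simp only [flowExt_eq hx hs.1]
  · rfl

theorem Z_ext (hφ : IsFlow φ x₀) (hf : IsJumpMap f κ) (hx₀ : 0 ≤ x₀) {n : ℕ} {τ : Fin n → ℝ}
    (hτ : ∀ k, 0 ≤ τ k) (k : Fin (n + 1)) :
    0 ≤ Z φ f x₀ τ k ∧ Z (flowExt φ) (jumpExt f) x₀ τ k = Z φ f x₀ τ k := by
  induction k using Fin.induction with
  | zero => exact ⟨hx₀, rfl⟩
  | succ k ih =>
    have h := hφ.nonneg _ ih.1 _ (hτ k)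
    rw [Z_succ, Z_succ, ih.2, flowExt_eq ih.1 (hτ k), jumpExt_eq h]
    exact ⟨hf.diffeo.bijOn.mapsTo h, rfl⟩

theorem prod_jumpTimeDensity_eq (hφ : IsFlow φ x₀) (hf : IsJumpMap f κ) (hx₀ : 0 ≤ x₀) {n : ℕ}
    (τ : Fin n → ℝ) :
    ∏ k : Fin n, jumpTimeDensity φ lam (Z φ f x₀ τ k.castSucc) (τ k) =
      pathWeight (flowExt φ) (jumpExt f) (jumpTimeDensity (flowExt φ) lam) x₀ τ := by
  by_cases hτ : ∀ k, 0 ≤ τ k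
  · refine Finset.prod_congr rfl fun k _ => ?_
    obtain ⟨h0, h⟩ := Z_ext hφ hf hx₀ hτ k.castSucc
    rw [h, jumpTimeDensity_flowExt h0]
  · push Not at hτ
    obtain ⟨k, hk⟩ := hτ
    rw [pathWeight, Finset.prod_eq_zero (Finset.mem_univ k) (jumpTimeDensity_of_neg hk),
      Finset.prod_eq_zero (Finset.mem_univ k) (jumpTimeDensity_of_neg hk)]

theorem risk_eq (hφ : IsFlow φ x₀) (hf : IsJumpMap f κ) (hx₀ : 0 ≤ x₀) (hl : Continuous lam)
    (I : Set ℝ) {n : ℕ} (est : (Fin (n + 1) → ℝ) → ℝ → ℝ) :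
    risk φ f x₀ I lam est = ∫⁻ τ : Fin n → ℝ,
      pathWeight (flowExt φ) (jumpExt f) (jumpTimeDensity (flowExt φ) lam) x₀ τ *
        ∫⁻ x in I, ENNReal.ofReal
          ((est (Z (flowExt φ) (jumpExt f) x₀ τ) x - lam x) ^ 2) := by
  have hm := measurable_pathWeight hφ.continuous_flowExt.measurable
    hf.continuous_jumpExt.measurable (measurable_jumpTimeDensity hφ.continuous_flowExt hl) x₀ n
  -- The loss is not assumed measurable here; finiteness of the density is used instead.
  rw [risk, law, funext fun τ => prod_jumpTimeDensity_eq hφ hf hx₀ (lam := lam) (n := n) τ,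
    lintegral_withDensity_eq_lintegral_mul_non_measurable _ hm]
  · refine lintegral_congr fun τ => ?_
    simp only [Pi.mul_apply]
    by_cases hτ : ∀ k, 0 ≤ τ k
    · rw [funext fun k => (Z_ext hφ hf hx₀ hτ k).2]
    · push Not at hτ
      obtain ⟨k, hk⟩ := hτ
      rw [pathWeight, Finset.prod_eq_zero (Finset.mem_univ k) (jumpTimeDensity_of_neg hk),
        zero_mul, zero_mul]
  · refine Filter.Eventually.of_forall fun τ => ENNReal.prod_lt_top fun k _ => ?_
    unfold jumpTimeDensity
    split_ifs <;> simp

end Extension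

/-! ### A base rate strictly inside the class. -/

section RateClass

open Filter Topology

variable {f m M : ℝ → ℝ} {κ : ℝ}

theorem IsJumpMap.inv_spec (hf : IsJumpMap f κ) {u : ℝ} (hu : 0 ≤ u) :
    0 ≤ inv f u ∧ f (inv f u) = u := by
  obtain ⟨x, hx, h⟩ := hf.diffeo.bijOn.surjOn hu
  exact Function.invFunOn_pos ⟨x, hx, h⟩

theorem IsJumpMap.continuousAt (hf : IsJumpMap f κ) {x : ℝ} (hx : 0 < x) : ContinuousAt f x :=
  hf.diffeo.contDiffOn.continuousOn.continuousAt (Ici_mem_nhds hx)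

/-- A rate that is dominated by `p` on `[i₁, r]`, by `ε` just below `i₁`, by `p + q` just below
`r`, and that vanishes near the origin, satisfies the integral condition of the class. -/
theorem lintegral_rate_le (hf : IsJumpMap f κ) {i₁ i₀ r₀ r B p q ε : ℝ} {lam : ℝ → ℝ}
    (hi₀ : 0 < i₀) (h01 : i₀ ≤ i₁) (h1r : i₁ ≤ r₀) (hrr : r₀ ≤ r) (hp : 0 ≤ p) (hq : 0 ≤ q)
    (hε : 0 ≤ ε) (hM : ContinuousOn M (Ioi 0)) (hM₀ : ∀ y, 0 < y → 0 ≤ M y) (hB : 0 ≤ B)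
    (hMB : ∀ y ∈ Icc (f i₀) (f r), M y ≤ B)
    (h1 : ∀ x, x < i₀ → lam x ≤ 0) (h2 : ∀ x, x < i₁ → lam x ≤ ε) (h3 : ∀ x, x < r₀ → lam x ≤ p)
    (h4 : ∀ x ∈ Icc r₀ r, lam x ≤ p + q) :
    ∫⁻ u in Ioc 0 (f r), ENNReal.ofReal (M u * lam (inv f u)) ≤
      ENNReal.ofReal ((p * ∫ u in (f i₁)..(f r), M u) + ε * B * (f i₁ - f i₀) +
        q * B * (f r - f r₀)) := by
  have hi₁ : 0 < i₁ := hi₀.trans_le h01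
  have hr₀ : 0 < r₀ := hi₁.trans_le h1r
  have hr : 0 < r := hr₀.trans_le hrr
  have hmono := hf.strictMonoOn.monotoneOn
  have hfi₀ := (hf.bounds i₀ hi₀).1
  have hfi₁ := (hf.bounds i₁ hi₁).1
  have hf01 : f i₀ ≤ f i₁ := hmono hi₀.le hi₁.le h01
  have hf1r : f i₁ ≤ f r₀ := hmono hi₁.le hr₀.le h1r
  have hfrr : f r₀ ≤ f r := hmono hr₀.le hr.le hrr
  have hMi : IntegrableOn (fun u => p * M u) (Icc (f i₁) (f r)) :=
    ((hM.mono fun u hu => hfi₁.trans_le hu.1).integrableOn_Icc).const_mul p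
  have hF : ENNReal.ofReal (p * ∫ u in (f i₁)..(f r), M u) =
      ∫⁻ u in Icc (f i₁) (f r), ENNReal.ofReal (p * M u) := by
    rw [← intervalIntegral.integral_const_mul, intervalIntegral.integral_of_le (hf1r.trans hfrr),
      ← integral_Icc_eq_integral_Ioc, ofReal_integral_eq_lintegral_ofReal hMi]
    exact (ae_restrict_mem measurableSet_Icc).mono fun u hu =>
      mul_nonneg hp (hM₀ u (hfi₁.trans_le hu.1))
  have hF0 : 0 ≤ p * ∫ u in (f i₁)..(f r), M u :=
    mul_nonneg hp (intervalIntegral.integral_nonneg (hf1r.trans hfrr) fun u hu =>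
      hM₀ u (hfi₁.trans_le hu.1))
  have e1 : 0 ≤ ε * B * (f i₁ - f i₀) := mul_nonneg (by positivity) (by linarith)
  have e2 : 0 ≤ q * B * (f r - f r₀) := mul_nonneg (by positivity) (by linarith)
  rw [ENNReal.ofReal_add (by positivity) e2, ENNReal.ofReal_add hF0 e1, hF,
    ENNReal.ofReal_mul (by positivity), ENNReal.ofReal_mul (by positivity : 0 ≤ q * B),
    ← Real.volume_Icc, ← Real.volume_Icc, ← lintegral_indicator_const measurableSet_Icc,
    ← lintegral_indicator_const measurableSet_Icc, ← lintegral_indicator measurableSet_Icc,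
    ← lintegral_indicator measurableSet_Ioc, ← lintegral_add_right _
      (measurable_const.indicator measurableSet_Icc), ← lintegral_add_right _
      (measurable_const.indicator measurableSet_Icc)]
  -- The comparison is pointwise, according to where `f⁻¹(u)` lies relative to `i₀`, `i₁` and `r₀`.
  refine lintegral_mono fun u => ?_
  by_cases hu : u ∈ Ioc 0 (f r)
  swap
  · rw [indicator_of_notMem hu]
    exact zero_le
  rw [indicator_of_mem hu]
  obtain ⟨hx0, hxu⟩ := hf.inv_spec hu.1.le
  set x := inv f u
  have hxr : x ≤ r := (hf.strictMonoOn.le_iff_le hx0 hr.le).1 (hxu ▸ hu.2)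
  have hMu := hM₀ u hu.1
  rcases lt_or_ge x i₀ with hx | hx
  · rw [ENNReal.ofReal_of_nonpos (mul_nonpos_of_nonneg_of_nonpos hMu (h1 x hx))]
    exact zero_le
  have hu0 : f i₀ ≤ u := hxu ▸ hmono hi₀.le hx0 hx
  have hMuB := hMB u ⟨hu0, hu.2⟩
  rcases lt_or_ge x i₁ with hx1 | hx1
  · have hu1 : u ≤ f i₁ := hxu ▸ hmono hx0 hi₁.le hx1.le
    refine le_add_right (le_add_left ?_)
    rw [indicator_of_mem (show u ∈ Icc (f i₀) (f i₁) from ⟨hu0, hu1⟩)]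
    refine ENNReal.ofReal_le_ofReal ?_
    calc M u * lam x ≤ M u * ε := mul_le_mul_of_nonneg_left (h2 x hx1) hMu
      _ ≤ ε * B := by rw [mul_comm]; gcongr
  have hu1 : f i₁ ≤ u := hxu ▸ hmono hi₁.le hx0 hx1
  rcases lt_or_ge x r₀ with hx2 | hx2
  · refine le_add_right (le_add_right ?_)
    rw [indicator_of_mem (show u ∈ Icc (f i₁) (f r) from ⟨hu1, hu.2⟩)]
    refine ENNReal.ofReal_le_ofReal ?_
    rw [mul_comm p]
    exact mul_le_mul_of_nonneg_left (h3 x hx2) hMu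
  · have hu2 : f r₀ ≤ u := hxu ▸ hmono hr₀.le hx0 hx2
    rw [indicator_of_mem (show u ∈ Icc (f i₁) (f r) from ⟨hu1, hu.2⟩),
      indicator_of_mem (show u ∈ Icc (f r₀) (f r) from ⟨hu2, hu.2⟩)]
    refine le_trans ?_ (add_le_add le_self_add le_rfl)
    rw [← ENNReal.ofReal_add (by positivity) (by positivity)]
    refine ENNReal.ofReal_le_ofReal ?_
    calc M u * lam x ≤ M u * (p + q) := mul_le_mul_of_nonneg_left (h4 x ⟨hx2, hxr⟩) hMu
      _ = p * M u + q * M u := by ring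
      _ ≤ _ := by gcongr

/-- The base is `ε` from `i₁` on, plus a large tail from `r` on, both switched on by steep
continuous ramps. The strict inequality `hεL` leaves room in the integral condition for the ramps
and for perturbations up to `η`. -/
theorem exists_base_rate (hf : IsJumpMap f κ) (hm : ContinuousOn m (Ioi 0))
    (hM : ContinuousOn M (Ioi 0)) (hm₀ : ∀ y, 0 < y → 0 < m y) (hM₀ : ∀ y, 0 < y → 0 ≤ M y)
    {i₁ i₂ r L a ε b : ℝ} (hi₁ : 0 < i₁) (hi : i₁ < i₂) (hr : i₂ < r) (ha : 0 < a) (hε : 0 < ε)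
    (hb : 0 < b) (hεL : ε * ∫ u in (f i₁)..(f r), M u < L) :
    ∃ (base : ℝ → ℝ) (η : ℝ), 0 < η ∧ Continuous base ∧ (∀ x, 0 ≤ base x) ∧
      (∀ x ∈ Icc i₁ i₂, base x = ε) ∧ (∀ x, r ≤ x → 1 ≤ base x) ∧
      ∀ c : ℝ → ℝ, Continuous c → (∀ x, 0 ≤ c x) → (∀ x, c x ≤ η) →
        (∀ x ∉ Icc i₁ i₂, c x = 0) → MemE f m M r L a ε b i₁ (fun x => base x + c x) := by
  have hr0 : 0 < r := by linarith
  have hmono := hf.strictMonoOn.monotoneOn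
  set F := ∫ u in (f i₁)..(f r), M u with hF
  have hF0 : 0 ≤ F := intervalIntegral.integral_nonneg
    (hmono hi₁.le hr0.le (by linarith)) fun u hu => hM₀ u ((hf.bounds i₁ hi₁).1.trans_le hu.1)
  obtain ⟨η, hη, hηL⟩ : ∃ η, 0 < η ∧ (ε + η) * F < L := by
    refine ⟨(L - ε * F) / (2 * (F + 1)), by apply div_pos <;> linarith, ?_⟩
    have : (L - ε * F) / (2 * (F + 1)) * F ≤ (L - ε * F) / 2 := by
      rw [div_mul_eq_mul_div, div_le_div_iff₀ (by positivity) (by positivity)]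
      nlinarith
    linarith
  -- The second summand is what the tail condition demands. The `1` makes the rate at least `1`
  -- beyond `r`, so that the next jump time is almost surely finite.
  set tail : ℝ → ℝ := fun x => 1 + a * (f (max x i₁) ^ b / m (f (max x i₁))) with htail
  have hfp : ∀ x, 0 < f (max x i₁) := fun x => (hf.bounds _ (hi₁.trans_le (le_max_right _ _))).1
  have hfc : Continuous fun x => f (max x i₁) :=
    hf.diffeo.contDiffOn.continuousOn.comp_continuous (by fun_prop)
      fun x => hi₁.le.trans (le_max_right x i₁)
  have hmc : Continuous fun x => m (f (max x i₁)) := hm.comp_continuous hfc hfp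
  have htc : Continuous tail :=
    continuous_const.add (continuous_const.mul ((hfc.rpow_const fun _ => Or.inr hb.le).div hmc
      fun x => (hm₀ _ (hfp x)).ne'))
  have ht1 : ∀ x, 1 ≤ tail x := fun x => by
    have := hm₀ _ (hfp x)
    have := hfp x
    have : 0 ≤ a * (f (max x i₁) ^ b / m (f (max x i₁))) := by positivity
    simp only [htail]
    linarith
  obtain ⟨T, hT⟩ := (isCompact_Icc (a := (0 : ℝ)) (b := r)).bddAbove_image htc.continuousOn
  have hT0 : 0 ≤ T := by
    have := hT ⟨0, ⟨le_rfl, hr0.le⟩, rfl⟩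
    linarith [ht1 0]
  obtain ⟨B₀, hB₀⟩ := (isCompact_Icc (a := f (i₁ / 2)) (b := f r)).bddAbove_image
    (hM.mono fun y hy => (hf.bounds _ (half_pos hi₁)).1.trans_le hy.1)
  set B := max B₀ 0 with hB
  have hB0 : 0 ≤ B := le_max_right _ _
  have hlim : Tendsto (fun δ => (ε + η) * F + ε * B * (f i₁ - f (i₁ - δ)) +
      T * B * (f r - f (r - δ))) (𝓝[>] 0) (𝓝 ((ε + η) * F)) := by
    have hc1 : Tendsto (fun δ => f (i₁ - δ)) (𝓝[>] 0) (𝓝 (f i₁)) := by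
      refine (hf.continuousAt hi₁).tendsto.comp (Tendsto.mono_left ?_ nhdsWithin_le_nhds)
      exact Continuous.tendsto' (by fun_prop) _ _ (sub_zero _)
    have hc2 : Tendsto (fun δ => f (r - δ)) (𝓝[>] 0) (𝓝 (f r)) := by
      refine (hf.continuousAt hr0).tendsto.comp (Tendsto.mono_left ?_ nhdsWithin_le_nhds)
      exact Continuous.tendsto' (by fun_prop) _ _ (sub_zero _)
    have := ((hc1.const_sub (f i₁)).const_mul (ε * B)).const_add ((ε + η) * F) |>.add
      ((hc2.const_sub (f r)).const_mul (T * B))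
    simpa using this
  -- The ramps have width `δ`: small enough that their integral cost fits under `L`, that the first
  -- stays away from the origin, and that the second starts after `i₂`.
  obtain ⟨δ, hδL, hδ0, hδ⟩ := ((hlim.eventually_lt_const hηL).and
    (Ioo_mem_nhdsGT (show (0 : ℝ) < min (i₁ / 2) (r - i₂) by
      apply lt_min <;> linarith))).exists
  have hδ1 : δ < i₁ / 2 := hδ.trans_le (min_le_left _ _)
  have hδ2 : δ < r - i₂ := hδ.trans_le (min_le_right _ _)
  set ramp : ℝ → ℝ → ℝ := fun z x => max 0 (min 1 ((x - z) / δ + 1)) with hramp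
  have hrc : ∀ z, Continuous (ramp z) := fun z => by simp only [hramp]; fun_prop
  have hr_nonneg : ∀ z x, 0 ≤ ramp z x := fun z x => le_max_left _ _
  have hr_le : ∀ z x, ramp z x ≤ 1 := fun z x => max_le zero_le_one (min_le_left _ _)
  have hr_one : ∀ z x, z ≤ x → ramp z x = 1 := fun z x h => by
    have : 0 ≤ (x - z) / δ := div_nonneg (by linarith) hδ0.le
    simp only [hramp]
    rw [min_eq_left (by linarith), max_eq_right zero_le_one]
  have hr_zero : ∀ z x, x ≤ z - δ → ramp z x = 0 := fun z x h => by
    have : (x - z) / δ ≤ -1 := by rw [div_le_iff₀ hδ0]; linarith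
    simp only [hramp]
    exact max_eq_left ((min_le_right _ _).trans (by linarith))
  have hbase0 : ∀ x, 0 ≤ ε * ramp i₁ x + tail x * ramp r x := fun x =>
    add_nonneg (mul_nonneg hε.le (hr_nonneg _ _))
      (mul_nonneg (zero_le_one.trans (ht1 x)) (hr_nonneg _ _))
  have hbaser : ∀ x, r ≤ x → tail x ≤ ε * ramp i₁ x + tail x * ramp r x := fun x hx => by
    rw [hr_one r x hx, mul_one]
    linarith [mul_nonneg hε.le (hr_nonneg i₁ x)]
  have hε1 : ∀ x, ε * ramp i₁ x ≤ ε := fun x => mul_le_of_le_one_right hε.le (hr_le _ _)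
  refine ⟨fun x => ε * ramp i₁ x + tail x * ramp r x, η, hη,
    (continuous_const.mul (hrc _)).add (htc.mul (hrc _)), hbase0, fun x hx => ?_,
    fun x hx => (ht1 x).trans (hbaser x hx), fun c hc hc0 hcη hcI => ?_⟩
  · simp only
    rw [hr_one i₁ x hx.1, hr_zero r x (by linarith [hx.2])]
    ring
  refine { continuousOn := ?_, nonneg := ?_, tail := ?_, integral_le := ?_, lower := ?_ }
  · exact (((continuous_const.mul (hrc _)).add (htc.mul (hrc _))).add hc).continuousOn
  · exact fun x _ => add_nonneg (hbase0 x) (hc0 x)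
  · intro x hx
    rw [le_div_iff₀ ha]
    have h1 := hbaser x hx
    have h2 : tail x = 1 + a * (f x ^ b / m (f x)) := by
      simp only [htail]
      rw [max_eq_left (by linarith)]
    have := hc0 x
    linarith
  · refine (lintegral_rate_le (i₀ := i₁ - δ) (i₁ := i₁) (r₀ := r - δ) (B := B) (p := ε + η)
      (q := T) (ε := ε) (lam := fun x => ε * ramp i₁ x + tail x * ramp r x + c x) hf (by linarith) (by linarith) (by linarith) (by linarith) (by linarith)
      hT0 hε.le hM hM₀ hB0 ?_ ?_ ?_ ?_ ?_).trans (ENNReal.ofReal_le_ofReal hδL.le)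
    · intro y hy
      refine (hB₀ ⟨y, ⟨?_, hy.2⟩, rfl⟩).trans (le_max_left _ _)
      exact (hmono (half_pos hi₁).le (show (0 : ℝ) ≤ i₁ - δ by linarith) (by linarith)).trans hy.1
    · intro x hx
      rw [hr_zero i₁ x hx.le, hr_zero r x (by linarith), hcI x (fun h => by linarith [h.1])]
      simp
    · intro x hx
      rw [hr_zero r x (by linarith), hcI x (fun h => by linarith [h.1])]
      linarith [hε1 x]
    · intro x hx
      rw [hr_zero r x hx.le]
      linarith [hε1 x, hcη x]
    · intro x hx
      have h1 : tail x * ramp r x ≤ T :=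
        (mul_le_of_le_one_right (by linarith [ht1 x]) (hr_le _ _)).trans
          (hT ⟨x, ⟨by linarith [hx.1], hx.2⟩, rfl⟩)
      linarith [hε1 x, hcη x]
  · intro x hx
    simp only
    rw [hr_one i₁ x hx.1]
    have := hc0 x
    have := mul_nonneg (zero_le_one.trans (ht1 x)) (hr_nonneg r x)
    linarith

end RateClass

/-! ### Sums of disjoint bumps and their Hölder norms. -/

section Bumps

open scoped ContDiff

/-- A smooth bump with values in `[0,1]`, supported in `(0,1)` and equal to `1` on
`[1/4,3/4]`. -/
def bump : ContDiffBump (1 / 2 : ℝ) := ⟨1 / 4, 3 / 8, by norm_num, by norm_num⟩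

theorem tsupport_bump_subset : tsupport bump ⊆ Ioo (0 : ℝ) 1 := by
  rw [bump.tsupport_eq]
  intro x hx
  rw [Metric.mem_closedBall, Real.dist_eq, abs_le] at hx
  norm_num [bump] at hx
  constructor <;> linarith

theorem bump_eq_one {y : ℝ} (hy : y ∈ Icc (1 / 4 : ℝ) (3 / 4)) : bump y = 1 := by
  refine bump.one_of_mem_closedBall ?_
  rw [Metric.mem_closedBall, Real.dist_eq, abs_le]
  norm_num [bump]
  constructor <;> linarith [hy.1, hy.2]

theorem bump_eq_zero {y : ℝ} (hy : y ∉ Ioo (0 : ℝ) 1) : bump y = 0 :=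
  image_eq_zero_of_notMem_tsupport fun h => hy (tsupport_bump_subset h)

theorem contDiff_bump : ContDiff ℝ ∞ bump := bump.contDiff

theorem iteratedDeriv_bump_eq_zero (j : ℕ) {y : ℝ} (hy : y ∉ Ioo (0 : ℝ) 1) :
    iteratedDeriv j bump y = 0 := by
  have h : iteratedFDeriv ℝ j bump y = 0 := by
    by_contra h
    exact hy (tsupport_bump_subset (support_iteratedFDeriv_subset (𝕜 := ℝ) j h))
  rw [iteratedDeriv, h]
  rfl

theorem exists_bound_iteratedDeriv_bump (j : ℕ) :
    ∃ B, 0 ≤ B ∧ ∀ y, |iteratedDeriv j bump y| ≤ B := by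
  obtain ⟨B, hB⟩ := (isCompact_Icc (a := (0 : ℝ)) (b := 1)).exists_bound_of_continuousOn
    (contDiff_bump.continuous_iteratedDeriv j (by exact_mod_cast le_top)).continuousOn
  refine ⟨max B 0, le_max_right _ _, fun y => ?_⟩
  by_cases hy : y ∈ Ioo (0 : ℝ) 1
  · exact (hB y (Ioo_subset_Icc_self hy)).trans (le_max_left _ _)
  · rw [iteratedDeriv_bump_eq_zero j hy, abs_zero]
    exact le_max_right _ _

variable {m : ℕ}

theorem fin_eq_of_sub_mem {y : ℝ} {k l : Fin m} (hk : y - (k : ℕ) ∈ Ioo (0 : ℝ) 1)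
    (hl : y - (l : ℕ) ∈ Ioo (0 : ℝ) 1) : k = l := by
  have h1 : ((k : ℕ) : ℝ) < (l : ℕ) + 1 := by linarith [hk.1, hl.2]
  have h2 : ((l : ℕ) : ℝ) < (k : ℕ) + 1 := by linarith [hl.1, hk.2]
  have h1' : (k : ℕ) < l + 1 := by exact_mod_cast h1
  have h2' : (l : ℕ) < k + 1 := by exact_mod_cast h2
  ext; omega

theorem sum_shift_eq {h : ℝ → ℝ} (h0 : ∀ y ∉ Ioo (0 : ℝ) 1, h y = 0) (c : Fin m → ℝ) {y : ℝ}
    {k : Fin m} (hk : y - (k : ℕ) ∈ Ioo (0 : ℝ) 1) :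
    ∑ l, c l * h (y - (l : ℕ)) = c k * h (y - (k : ℕ)) := by
  refine Finset.sum_eq_single k (fun l _ hl => ?_) (by simp)
  rw [h0 _ fun h => hl (fin_eq_of_sub_mem h hk), mul_zero]

theorem sum_shift_eq_zero {h : ℝ → ℝ} (h0 : ∀ y ∉ Ioo (0 : ℝ) 1, h y = 0) (c : Fin m → ℝ) {y : ℝ}
    (hy : ∀ k : Fin m, y - (k : ℕ) ∉ Ioo (0 : ℝ) 1) :
    ∑ l, c l * h (y - (l : ℕ)) = 0 :=
  Finset.sum_eq_zero fun l _ => by rw [h0 _ (hy l), mul_zero]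

/-- At most one shift is nonzero at a given point, so the bound does not grow with the number of
cells. -/
theorem abs_sum_shift_le {h : ℝ → ℝ} (h0 : ∀ y ∉ Ioo (0 : ℝ) 1, h y = 0) {B : ℝ} (hB : 0 ≤ B)
    (hb : ∀ y, |h y| ≤ B) {c : Fin m → ℝ} (hc : ∀ k, |c k| ≤ 1) (y : ℝ) :
    |∑ l, c l * h (y - (l : ℕ))| ≤ B := by
  by_cases hy : ∃ k : Fin m, y - (k : ℕ) ∈ Ioo (0 : ℝ) 1
  · obtain ⟨k, hk⟩ := hy
    rw [sum_shift_eq h0 c hk, abs_mul]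
    exact (mul_le_of_le_one_left (abs_nonneg _) (hc k)).trans (hb _)
  · rw [sum_shift_eq_zero h0 c (not_exists.1 hy), abs_zero]
    exact hB

/-- The sum of the bumps on `[k, k + 1]` for the indices `k` selected by `θ`. -/
def comb (θ : Fin m → Bool) (y : ℝ) : ℝ :=
  ∑ k, (if θ k then 1 else 0) * bump (y - (k : ℕ))

theorem contDiff_comb (θ : Fin m → Bool) : ContDiff ℝ ∞ (comb θ) :=
  ContDiff.sum fun _ _ => contDiff_const.mul (contDiff_bump.comp (contDiff_id.sub contDiff_const))

theorem comb_eq {θ : Fin m → Bool} {y : ℝ} {k : Fin m} (hk : y - (k : ℕ) ∈ Ioo (0 : ℝ) 1) :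
    comb θ y = (if θ k then 1 else 0) * bump (y - (k : ℕ)) :=
  sum_shift_eq (fun _ => bump_eq_zero) _ hk

theorem comb_eq_zero {θ : Fin m → Bool} {y : ℝ} (hy : y ∉ Icc (0 : ℝ) m) : comb θ y = 0 := by
  refine sum_shift_eq_zero (fun _ => bump_eq_zero) _ fun k hk => hy ⟨?_, ?_⟩
  · have : (0 : ℝ) ≤ (k : ℕ) := Nat.cast_nonneg _
    linarith [hk.1]
  · have : ((k : ℕ) : ℝ) + 1 ≤ m := by exact_mod_cast k.2
    linarith [hk.2]

theorem comb_nonneg (θ : Fin m → Bool) (y : ℝ) : 0 ≤ comb θ y :=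
  Finset.sum_nonneg fun k _ => mul_nonneg (by split_ifs <;> norm_num) bump.nonneg

theorem comb_le_one (θ : Fin m → Bool) (y : ℝ) : comb θ y ≤ 1 :=
  (le_abs_self _).trans <| abs_sum_shift_le (fun _ => bump_eq_zero) zero_le_one
    (fun y => by rw [abs_of_nonneg bump.nonneg]; exact bump.le_one)
    (fun k => by split_ifs <;> norm_num) y

theorem mem_Icc_of_comb_update_ne {θ : Fin m → Bool} {k : Fin m} {b : Bool} {y : ℝ}
    (h : comb θ y ≠ comb (Function.update θ k b) y) : y ∈ Icc ((k : ℕ) : ℝ) ((k : ℕ) + 1) := by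
  by_contra hy
  refine h (Finset.sum_congr rfl fun l _ => ?_)
  by_cases hl : l = k
  · subst hl
    rw [bump_eq_zero, mul_zero, mul_zero]
    exact fun h => hy ⟨by linarith [h.1], by linarith [h.2]⟩
  · rw [Function.update_of_ne hl]

theorem iteratedDeriv_comb (θ : Fin m → Bool) (j : ℕ) (y : ℝ) :
    iteratedDeriv j (comb θ) y =
      ∑ k, (if θ k then 1 else 0) * iteratedDeriv j bump (y - (k : ℕ)) := by
  have hs : ∀ k : Fin m, ContDiffAt ℝ j (fun y : ℝ => bump (y - (k : ℕ))) y := fun k =>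
    ((contDiff_bump.comp (contDiff_id.sub contDiff_const)).of_le
      (by exact_mod_cast le_top)).contDiffAt
  unfold comb
  rw [iteratedDeriv_fun_sum fun k _ => contDiffAt_const.mul (hs k)]
  refine Finset.sum_congr rfl fun k _ => ?_
  rw [iteratedDeriv_const_mul_field, iteratedDeriv_comp_sub_const]

theorem exists_bound_iteratedDeriv_comb (j : ℕ) :
    ∃ B, 0 ≤ B ∧ ∀ (m : ℕ) (θ : Fin m → Bool) (y : ℝ), |iteratedDeriv j (comb θ) y| ≤ B := by
  obtain ⟨B, hB, hb⟩ := exists_bound_iteratedDeriv_bump j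
  refine ⟨B, hB, fun m θ y => ?_⟩
  rw [iteratedDeriv_comb]
  exact abs_sum_shift_le (fun y => iteratedDeriv_bump_eq_zero j) hB hb
    (fun k => by split_ifs <;> norm_num) y

/-- At distance at most `1` the mean value theorem applies, as the exponent is at most `1`; at
larger distance the sup bound suffices. Both bounds are uniform in `m` and `θ`. -/
theorem exists_holder_comb {α : ℝ} (hα : 0 < α) :
    ∃ K, 0 < K ∧ ∀ (m : ℕ) (θ : Fin m → Bool) (y z : ℝ),
      |iteratedDeriv ⌊α⌋₊ (comb θ) y - iteratedDeriv ⌊α⌋₊ (comb θ) z| ≤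
        K * |y - z| ^ (α - ⌊α⌋₊) := by
  obtain ⟨B, hB, hb⟩ := exists_bound_iteratedDeriv_comb ⌊α⌋₊
  obtain ⟨B', hB', hb'⟩ := exists_bound_iteratedDeriv_comb (⌊α⌋₊ + 1)
  have hβ0 : 0 ≤ α - ⌊α⌋₊ := sub_nonneg.2 (Nat.floor_le hα.le)
  have hβ1 : α - ⌊α⌋₊ ≤ 1 := by linarith [Nat.lt_floor_add_one α]
  refine ⟨2 * B + B' + 1, by positivity, fun m θ y z => ?_⟩
  rcases le_total |y - z| 1 with h | h
  · have hd : ∀ x, DifferentiableAt ℝ (iteratedDeriv ⌊α⌋₊ (comb θ)) x := fun x =>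
      (contDiff_comb θ).differentiable_iteratedDeriv _
        (by exact_mod_cast ENat.natCast_lt_top _) x
    have h1 := convex_univ.norm_image_sub_le_of_norm_deriv_le (C := B') (fun x _ => hd x)
      (fun x _ => by rw [← iteratedDeriv_succ]; exact hb' m θ x) (mem_univ z) (mem_univ y)
    have h2 : |y - z| ≤ |y - z| ^ (α - ⌊α⌋₊) := by
      rcases (abs_nonneg (y - z)).eq_or_lt with h0 | h0
      · rw [← h0]; exact Real.rpow_nonneg le_rfl _
      · simpa using Real.rpow_le_rpow_of_exponent_ge h0 h hβ1
    calc _ ≤ B' * |y - z| := h1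
      _ ≤ B' * |y - z| ^ (α - ⌊α⌋₊) := by gcongr
      _ ≤ _ := by gcongr; linarith
  · have h1 : 1 ≤ |y - z| ^ (α - ⌊α⌋₊) := Real.one_le_rpow h hβ0
    calc _ ≤ |iteratedDeriv ⌊α⌋₊ (comb θ) y| + |iteratedDeriv ⌊α⌋₊ (comb θ) z| := abs_sub _ _
      _ ≤ (2 * B + B' + 1) * 1 := by linarith [hb m θ y, hb m θ z]
      _ ≤ _ := by gcongr

/-- Taking differences removes the constant `ε` also for `j = 0`, so orders below and above one are
treated alike. -/
theorem iteratedDeriv_const_add_comb (θ : Fin m → Bool) (ε c s i : ℝ) (j : ℕ) (x y : ℝ) :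
    iteratedDeriv j (fun x => ε + c * comb θ ((x - i) * s)) x -
        iteratedDeriv j (fun x => ε + c * comb θ ((x - i) * s)) y =
      c * s ^ j * (iteratedDeriv j (comb θ) ((x - i) * s) -
        iteratedDeriv j (comb θ) ((y - i) * s)) := by
  have hc : ContDiff ℝ j (comb θ) := (contDiff_comb θ).of_le (by exact_mod_cast le_top)
  have h : ∀ x, iteratedDeriv j (fun x => c * comb θ ((x - i) * s)) x =
      c * s ^ j * iteratedDeriv j (comb θ) ((x - i) * s) := fun x => by
    rw [iteratedDeriv_const_mul_field,
      iteratedDeriv_comp_sub_const (f := fun x => comb θ (x * s))]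
    simp only [mul_comm _ s]
    rw [iteratedDeriv_comp_const_mul hc]
    ring
  rcases Nat.eq_zero_or_pos j with rfl | hj
  · simp only [iteratedDeriv_zero]
    ring
  · rw [iteratedDeriv_const_add hj, iteratedDeriv_const_add hj, h, h]
    ring

/-- Rates that equal `ε` plus scaled bumps on the estimation interval lie in the Hölder ball. -/
theorem exists_mem_holderBall {α : ℝ} (hα : 0 < α) :
    ∃ K, 0 < K ∧ ∀ (m : ℕ) (θ : Fin m → Bool) (ε A h i₁ i₂ R : ℝ) (lam : ℝ → ℝ), 0 < h → 0 ≤ A →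
      0 ≤ ε → i₁ < i₂ →
      EqOn lam (fun x => ε + A * h ^ α * comb θ ((x - i₁) * h⁻¹)) (Icc i₁ i₂) →
      A * K + (ε + A * h ^ α) ≤ R → lam ∈ holderBall α (Icc i₁ i₂) R := by
  obtain ⟨K, hK, hk⟩ := exists_holder_comb hα
  refine ⟨K, hK, fun m θ ε A h i₁ i₂ R lam hh hA hε hi hlam hR => ?_⟩
  set G : ℝ → ℝ := fun x => ε + A * h ^ α * comb θ ((x - i₁) * h⁻¹) with hG
  have hGc : ContDiff ℝ ∞ G := contDiff_const.add (contDiff_const.mul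
    ((contDiff_comb θ).comp ((contDiff_id.sub contDiff_const).mul contDiff_const)))
  have hGc' : ContDiff ℝ (⌊α⌋₊ : ℕ) G := hGc.of_le (by exact_mod_cast le_top)
  have hd : ∀ x ∈ Icc i₁ i₂, iteratedDerivWithin ⌊α⌋₊ lam (Icc i₁ i₂) x =
      iteratedDeriv ⌊α⌋₊ G x := fun x hx => by
    rw [iteratedDerivWithin_congr hlam hx, iteratedDerivWithin_eq_iteratedDeriv
      (uniqueDiffOn_Icc hi) hGc'.contDiffAt hx]
  have hβ0 : 0 ≤ α - ⌊α⌋₊ := sub_nonneg.2 (Nat.floor_le hα.le)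
  -- The remaining power of `h` cancels the one that rescaling puts into the Hölder bound, so the
  -- seminorm is at most `A * K` for every `h`.
  have hcoef : A * h ^ α * h⁻¹ ^ ⌊α⌋₊ = A * h ^ (α - ⌊α⌋₊) := by
    rw [Real.rpow_sub hh, Real.rpow_natCast, inv_pow]
    ring
  have hhp : 0 ≤ h ^ α := Real.rpow_nonneg hh.le _
  refine ⟨hGc'.contDiffOn.congr hlam, ?_⟩
  refine le_trans ?_ (ENNReal.ofReal_le_ofReal hR)
  rw [ENNReal.ofReal_add (by positivity) (by positivity)]
  refine add_le_add (iSup₂_le fun t ht => ?_) (iSup₂_le fun x hx => ?_)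
  · have hmod : modulus (Icc i₁ i₂) (iteratedDerivWithin ⌊α⌋₊ lam (Icc i₁ i₂)) t ≤
        ENNReal.ofReal (A * K * t ^ (α - ⌊α⌋₊)) := by
      refine iSup₂_le fun x hx => iSup₂_le fun y hy => iSup_le fun hxy =>
        ENNReal.ofReal_le_ofReal ?_
      rw [hd x hx, hd y hy, iteratedDeriv_const_add_comb, hcoef, abs_mul,
        abs_of_nonneg (mul_nonneg hA (Real.rpow_nonneg hh.le _))]
      calc _ ≤ A * h ^ (α - ⌊α⌋₊) *
            (K * |(x - i₁) * h⁻¹ - (y - i₁) * h⁻¹| ^ (α - ⌊α⌋₊)) := by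
            gcongr
            exact hk m θ _ _
        _ = A * K * |x - y| ^ (α - ⌊α⌋₊) := by
          rw [← sub_mul, sub_sub_sub_cancel_right, abs_mul, abs_of_pos (inv_pos.2 hh),
            Real.mul_rpow (abs_nonneg _) (inv_pos.2 hh).le, Real.inv_rpow hh.le]
          have := (Real.rpow_pos_of_pos hh (α - ⌊α⌋₊)).ne'
          field_simp
        _ ≤ _ := by gcongr
    calc _ ≤ ENNReal.ofReal (t ^ ((⌊α⌋₊ : ℝ) - α)) *
          ENNReal.ofReal (A * K * t ^ (α - ⌊α⌋₊)) := by gcongr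
      _ = ENNReal.ofReal (A * K) := by
        rw [← ENNReal.ofReal_mul (Real.rpow_nonneg ht.le _), mul_left_comm, ← Real.rpow_add ht]
        simp
  · refine ENNReal.ofReal_le_ofReal ?_
    rw [hlam hx, abs_of_nonneg (by have := comb_nonneg θ ((x - i₁) * h⁻¹); positivity)]
    have := mul_le_mul_of_nonneg_left (comb_le_one θ ((x - i₁) * h⁻¹)) (mul_nonneg hA hhp)
    linarith

end Bumps

/-! ### The lower bound over the hypercube. -/

section LowerBound

open Filter Topology

variable {φ : ℝ → ℝ → ℝ} {f lam lam' : ℝ → ℝ} {x₀ κ r : ℝ}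

/-- Each trajectory eventually stays beyond `r`, where the rate is at least `1`. -/
theorem IsFlow.tendsto_integral_atTop (hφ : IsFlow φ x₀) (hx₀ : 0 ≤ x₀) (hl : Continuous lam)
    (h₀ : ∀ x, 0 ≤ lam x) (h₁ : ∀ x, r ≤ x → 1 ≤ lam x) {x : ℝ}
    (hx : x ∈ insert x₀ (Ioi (0 : ℝ))) :
    Tendsto (fun t => ∫ s in (0 : ℝ)..t, lam (flowExt φ x s)) atTop atTop := by
  have hx' := nonneg_of_mem_states hx₀ hx
  obtain ⟨T, hT, hTr⟩ := (hφ.diffeo x hx).bijOn.surjOn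
    (mem_Ici.2 (le_max_left x r))
  have hT : 0 ≤ T := hT
  have hc : Continuous fun s => lam (flowExt φ x s) :=
    hl.comp (hφ.continuous_flowExt.comp (Continuous.prodMk_right x))
  refine tendsto_atTop_mono' atTop ?_ (tendsto_atTop_add_const_right atTop (-T) tendsto_id)
  filter_upwards [eventually_ge_atTop T] with t ht
  rw [← intervalIntegral.integral_add_adjacent_intervals (hc.intervalIntegrable 0 T)
    (hc.intervalIntegrable T t)]
  have h1 : 0 ≤ ∫ s in (0 : ℝ)..T, lam (flowExt φ x s) :=
    intervalIntegral.integral_nonneg hT fun s _ => h₀ _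
  have h2 : ∫ s in T..t, (1 : ℝ) ≤ ∫ s in T..t, lam (flowExt φ x s) := by
    refine intervalIntegral.integral_mono_on ht (by simp) (hc.intervalIntegrable T t)
      fun s hs => h₁ _ ?_
    have hs0 : 0 ≤ s := hT.trans hs.1
    rw [flowExt_eq hx' hs0]
    calc r ≤ φ x T := hTr ▸ le_max_right _ _
      _ ≤ φ x s := (hφ.diffeo x hx).strictMonoOn.monotoneOn hT hs0 hs.1
  simp only [intervalIntegral.integral_const, smul_eq_mul, mul_one] at h2
  simp only [id]
  linarith

theorem flowExt_jump_mem (hφ : IsFlow φ x₀) (hf : IsJumpMap f κ) (hx₀ : 0 ≤ x₀) :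
    ∀ x ∈ insert x₀ (Ioi (0 : ℝ)), ∀ t, 0 ≤ t →
      jumpExt f (flowExt φ x t) ∈ insert x₀ (Ioi (0 : ℝ)) := fun x hx t ht => by
  have hx' := nonneg_of_mem_states hx₀ hx
  rw [flowExt_eq hx' ht, jumpExt_eq (hφ.nonneg x hx' t ht)]
  exact hφ.jump_mem_states hf hx₀ hx ht

theorem lintegral_pathDensity_le_one (hφ : IsFlow φ x₀) (hf : IsJumpMap f κ) (hx₀ : 0 ≤ x₀)
    (hl : Continuous lam) (h₀ : ∀ x, 0 ≤ lam x) (h₁ : ∀ x, r ≤ x → 1 ≤ lam x) (n : ℕ) :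
    ∫⁻ τ : Fin n → ℝ,
      pathWeight (flowExt φ) (jumpExt f) (jumpTimeDensity (flowExt φ) lam) x₀ τ ≤ 1 := by
  refine lintegral_pathWeight_le_one hφ.continuous_flowExt.measurable
    hf.continuous_jumpExt.measurable (measurable_jumpTimeDensity hφ.continuous_flowExt hl)
    (fun _ _ => jumpTimeDensity_of_neg) (flowExt_jump_mem hφ hf hx₀) (fun x hx => ?_) n
    (mem_insert _ _)
  exact (lintegral_hazard_eq_one
    (hl.comp (hφ.continuous_flowExt.comp (Continuous.prodMk_right x))) (fun t => h₀ _)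
    (hφ.tendsto_integral_atTop hx₀ hl h₀ h₁ hx)).le

/-- The Hellinger affinity of the laws of `n` jumps under two rates that differ by at most `d`
on a short interval. -/
theorem half_le_lintegral_affinity (hφ : IsFlow φ x₀) (hf : IsJumpMap f κ) (hx₀ : 0 ≤ x₀)
    (hl : Continuous lam) (hl' : Continuous lam') (h₀ : ∀ x, 0 ≤ lam x) (h₀' : ∀ x, 0 ≤ lam' x)
    (h₁ : ∀ x, r ≤ x → 1 ≤ lam x) (h₁' : ∀ x, r ≤ x → 1 ≤ lam' x) {u v ε d T : ℝ} (hε : 0 < ε)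
    (hne : ∀ x, lam x ≠ lam' x → x ∈ Icc u v)
    (hlε : ∀ x ∈ Icc u v, ε ≤ lam x) (hlε' : ∀ x ∈ Icc u v, ε ≤ lam' x)
    (hd : ∀ x, |lam x - lam' x| ≤ d) (hT : 0 ≤ T)
    (hV : ∀ x ∈ insert x₀ (Ioi (0 : ℝ)),
      volume {t | 0 ≤ t ∧ φ x t ∈ Icc u v} ≤ ENNReal.ofReal T)
    {n : ℕ} (hn : 1 ≤ n) (hnT : n * (d ^ 2 / (8 * ε) * T) ≤ 1 / 2) :
    1 / 2 ≤ ∫⁻ τ : Fin n → ℝ,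
      pathWeight (flowExt φ) (jumpExt f) (affinityDensity (flowExt φ) lam lam') x₀ τ := by
  set q := d ^ 2 / (8 * ε) * T with hq
  have hq0 : 0 ≤ q := by positivity
  have hn' : (1 : ℝ) ≤ n := by exact_mod_cast hn
  have hq1 : q ≤ 1 / 2 := by nlinarith
  have hstep : ∀ x ∈ insert x₀ (Ioi (0 : ℝ)),
      ENNReal.ofReal (1 - q) ≤ ∫⁻ t, affinityDensity (flowExt φ) lam lam' x t := fun x hx => by
    have hx' := nonneg_of_mem_states hx₀ hx
    have hc := hφ.continuous_flowExt.comp (Continuous.prodMk_right x)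
    have h := one_le_lintegral_affinity (v := fun t => lam (flowExt φ x t))
      (w := fun t => lam' (flowExt φ x t)) (hl.comp hc) (hl'.comp hc) (fun _ => h₀ _)
      (fun _ => h₀' _)
      (hφ.tendsto_integral_atTop hx₀ (lam := fun x => (lam x + lam' x) / 2) (by fun_prop)
        (fun y => by have := h₀ y; have := h₀' y; positivity)
        (fun y hy => by linarith [h₁ y hy, h₁' y hy]) hx)
      (c := d ^ 2 / (8 * ε)) (by positivity) (fun t _ htne => ?_)
      (V := ENNReal.ofReal T) ((measure_mono fun t ht => ?_).trans (hV x hx))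
    · rw [ENNReal.ofReal_sub _ hq0, ENNReal.ofReal_one, tsub_le_iff_right, hq,
        ENNReal.ofReal_mul (by positivity)]
      exact h
    · have hm := hne _ htne
      refine (mean_sub_sqrt_le hε (hlε _ hm) (hlε' _ hm)).trans ?_
      gcongr ?_ / _
      exact sq_le_sq' (neg_le_of_abs_le (hd _)) (le_of_abs_le (hd _))
    · refine ⟨ht.1, ?_⟩
      rw [← flowExt_eq (φ := φ) hx' ht.1]
      exact hne _ ht.2
  calc (1 / 2 : ℝ≥0∞) = ENNReal.ofReal (1 / 2) := by
        rw [ENNReal.ofReal_div_of_pos two_pos]; simp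
    _ ≤ ENNReal.ofReal ((1 - q) ^ n) := by
      refine ENNReal.ofReal_le_ofReal ?_
      -- Bernoulli's inequality: `(1 - q) ^ n ≥ 1 - n q ≥ 1/2`.
      have := one_add_mul_le_pow (a := -q) (by linarith) n
      rw [sub_eq_add_neg]
      linarith
    _ = ENNReal.ofReal (1 - q) ^ n := ENNReal.ofReal_pow (by linarith) n
    _ ≤ _ := pow_le_lintegral_pathWeight hφ.continuous_flowExt.measurable
      hf.continuous_jumpExt.measurable (measurable_affinityDensity hφ.continuous_flowExt hl hl')
      (fun _ _ => affinityDensity_of_neg) (flowExt_jump_mem hφ hf hx₀) hstep n (mem_insert _ _)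

/-- Pointwise, `(e - p)² + (e - q)² ≥ (p - q)² / 2` for every value of `e`. -/
theorem le_lintegral_sq_add {J : Set ℝ} (hJ : MeasurableSet J) {e p q : ℝ → ℝ} (he : Measurable e)
    (hp : Measurable p) {d : ℝ} (hd : ∀ x ∈ J, (p x - q x) ^ 2 = d ^ 2) :
    ENNReal.ofReal (d ^ 2 / 2) * volume J ≤
      (∫⁻ x in J, ENNReal.ofReal ((e x - p x) ^ 2)) +
        ∫⁻ x in J, ENNReal.ofReal ((e x - q x) ^ 2) := by
  rw [← setLIntegral_const, ← lintegral_add_left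
    (by exact ((he.sub hp).pow_const 2).ennreal_ofReal)]
  refine setLIntegral_mono' hJ fun x hx => ?_
  rw [← ENNReal.ofReal_add (sq_nonneg _) (sq_nonneg _)]
  refine ENNReal.ofReal_le_ofReal ?_
  nlinarith [sq_nonneg (2 * e x - p x - q x), hd x hx]

/-- The minimax bound over the hypercube of rates `base + d * comb θ` on the cells of length
`h` of the interval `[i₁, i₁ + m h]`. -/
theorem minimax_hypercube (hφ : IsFlow φ x₀) (hf : IsJumpMap f κ) (hx₀ : 0 ≤ x₀)
    {base : ℝ → ℝ} (hbc : Continuous base) (hb₀ : ∀ x, 0 ≤ base x)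
    (hb₁ : ∀ x, r ≤ x → 1 ≤ base x) {m n : ℕ} {i₁ i₂ h d ε K : ℝ} (hh : 0 < h)
    (hmh : m * h = i₂ - i₁) (hε : 0 < ε) (hbε : ∀ x ∈ Icc i₁ i₂, base x = ε) (hd : 0 ≤ d)
    (hK : 0 ≤ K) (hV : ∀ x ∈ insert x₀ (Ioi (0 : ℝ)), ∀ u v, i₁ ≤ u → u ≤ v → v ≤ i₂ →
      volume {t | 0 ≤ t ∧ φ x t ∈ Icc u v} ≤ ENNReal.ofReal (K * (v - u)))
    (hn : 1 ≤ n) (hnK : n * (d ^ 2 / (8 * ε) * (K * h)) ≤ 1 / 2)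
    {est : (Fin (n + 1) → ℝ) → ℝ → ℝ} (hest : Measurable (Function.uncurry est)) {s : ℝ≥0∞}
    (hs : ∀ θ : Fin m → Bool, risk φ f x₀ (Icc i₁ i₂)
      (fun x => base x + d * comb θ ((x - i₁) * h⁻¹)) est ≤ s) :
    m * (ENNReal.ofReal (d ^ 2 / 2) * ENNReal.ofReal (h / 2) / 8) ≤ 2 * s := by
  set lam : (Fin m → Bool) → ℝ → ℝ := fun θ x => base x + d * comb θ ((x - i₁) * h⁻¹) with hlam
  have hcomb : ∀ θ : Fin m → Bool, Continuous fun x => comb θ ((x - i₁) * h⁻¹) := fun θ =>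
    (contDiff_comb θ).continuous.comp (by fun_prop)
  have hl : ∀ θ, Continuous (lam θ) := fun θ => hbc.add (continuous_const.mul (hcomb θ))
  have hpert : ∀ (θ : Fin m → Bool) x, 0 ≤ d * comb θ ((x - i₁) * h⁻¹) := fun θ x =>
    mul_nonneg hd (comb_nonneg _ _)
  have h₀ : ∀ θ x, 0 ≤ lam θ x := fun θ x => add_nonneg (hb₀ x) (hpert θ x)
  have h₁ : ∀ θ x, r ≤ x → 1 ≤ lam θ x := fun θ x hx => by
    have := hb₁ x hx; have := hpert θ x; simp only [hlam]; linarith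
  have hk1 : ∀ k : Fin m, (k : ℝ) * h + h ≤ i₂ - i₁ := fun k => by
    have : ((k : ℕ) : ℝ) + 1 ≤ m := by exact_mod_cast k.2
    calc (k : ℝ) * h + h = (k + 1) * h := by ring
      _ ≤ m * h := by gcongr
      _ = _ := hmh
  have hk0 : ∀ k : Fin m, 0 ≤ (k : ℝ) * h := fun k => by positivity
  -- The middle half of each cell, where the bump is `1` and flipping the coordinate changes the
  -- rate by exactly `d`.
  set J : Fin m → Set ℝ := fun k => Icc (i₁ + (k * h + h / 4)) (i₁ + (k * h + 3 * h / 4)) with hJ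
  have hJI : ∀ k, J k ⊆ Icc i₁ i₂ := fun k =>
    Icc_subset_Icc (by linarith [hk0 k]) (by linarith [hk1 k])
  have hJmem : ∀ k, ∀ x ∈ J k, (x - i₁) * h⁻¹ - (k : ℕ) ∈ Icc (1 / 4 : ℝ) (3 / 4) :=
    fun k x hx => by
      rw [← div_eq_mul_inv]
      constructor
      · rw [le_sub_iff_add_le, le_div_iff₀ hh]
        linarith [hx.1]
      · rw [sub_le_iff_le_add, div_le_iff₀ hh]
        linarith [hx.2]
  have hJmem' : ∀ k, ∀ x ∈ J k, (x - i₁) * h⁻¹ - (k : ℕ) ∈ Ioo (0 : ℝ) 1 := fun k x hx =>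
    ⟨by linarith [(hJmem k x hx).1], by linarith [(hJmem k x hx).2]⟩
  have hJdisj : Pairwise (Function.onFun Disjoint J) := fun k l hkl =>
    disjoint_left.2 fun x hk hl => hkl (fin_eq_of_sub_mem (hJmem' k x hk) (hJmem' l x hl))
  have hlamJ : ∀ θ k, ∀ x ∈ J k, lam θ x = ε + d * (if θ k then 1 else 0) := fun θ k x hx => by
    simp only [hlam]
    rw [hbε x (hJI k hx), comb_eq (hJmem' k x hx), bump_eq_one (hJmem k x hx), mul_one]
  set Zx : (Fin n → ℝ) → Fin (n + 1) → ℝ := Z (flowExt φ) (jumpExt f) x₀ with hZx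
  have hZm : Measurable Zx := measurable_pi_lambda _ fun k =>
    measurable_Z hφ.continuous_flowExt.measurable hf.continuous_jumpExt.measurable x₀ k
  set P : (Fin m → Bool) → (Fin n → ℝ) → ℝ≥0∞ := fun θ =>
    pathWeight (flowExt φ) (jumpExt f) (jumpTimeDensity (flowExt φ) (lam θ)) x₀ with hP
  have hPm : ∀ θ, Measurable (P θ) := fun θ =>
    measurable_pathWeight hφ.continuous_flowExt.measurable hf.continuous_jumpExt.measurable
      (measurable_jumpTimeDensity hφ.continuous_flowExt (hl θ)) x₀ n
  set loss : (Fin m → Bool) → Fin m → (Fin n → ℝ) → ℝ≥0∞ := fun θ k τ =>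
    ∫⁻ x in J k, ENNReal.ofReal ((est (Zx τ) x - lam θ x) ^ 2) with hloss
  have hintm : ∀ θ, Measurable fun p : (Fin n → ℝ) × ℝ =>
      ENNReal.ofReal ((est (Zx p.1) p.2 - lam θ p.2) ^ 2) := fun θ =>
    ((((hest.comp ((hZm.comp measurable_fst).prodMk measurable_snd)).sub
      ((hl θ).measurable.comp measurable_snd)).pow_const 2)).ennreal_ofReal
  have hlossm : ∀ θ k, Measurable (loss θ k) := fun θ k => (hintm θ).lintegral_prod_right'
  refine assouad (R := fun θ => risk φ f x₀ (Icc i₁ i₂) (lam θ) est)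
    (ρ := fun θ k => ∫⁻ τ, P θ τ * loss θ k τ) (fun θ => ?_) (fun θ k => ?_) hs
  · rw [risk_eq hφ hf hx₀ (hl θ), ← lintegral_finsetSum _ fun k _ => by
      exact (hPm θ).mul (hlossm θ k)]
    refine lintegral_mono fun τ => ?_
    simp only
    rw [← Finset.mul_sum]
    gcongr
    simp only [hloss]
    rw [← tsum_fintype (L := .unconditional _),
      ← lintegral_iUnion (fun k => measurableSet_Icc) hJdisj]
    exact lintegral_mono_set (iUnion_subset hJI)
  · set θ' := Function.update θ k (!θ k) with hθ'
    refine two_point_bound (W := pathWeight (flowExt φ) (jumpExt f)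
      (affinityDensity (flowExt φ) (lam θ) (lam θ')) x₀) (hPm θ) (hPm θ')
      (pathWeight_sq (affinityDensity_sq hφ.continuous_flowExt (hl θ) (hl θ') (h₀ θ) (h₀ θ')) x₀)
      (lintegral_pathDensity_le_one hφ hf hx₀ (hl θ) (h₀ θ) (h₁ θ) n)
      (lintegral_pathDensity_le_one hφ hf hx₀ (hl θ') (h₀ θ') (h₁ θ') n) ?_ (hlossm θ k)
      fun τ => ?_
    · have hcell : ∀ x ∈ Icc (i₁ + k * h) (i₁ + (k * h + h)), x ∈ Icc i₁ i₂ := fun x hx =>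
        ⟨by linarith [hx.1, hk0 k], by linarith [hx.2, hk1 k]⟩
      have hge : ∀ θ, ∀ x ∈ Icc (i₁ + k * h) (i₁ + (k * h + h)), ε ≤ lam θ x :=
        fun θ x hx => by
          simp only [hlam]
          rw [hbε x (hcell x hx)]
          linarith [hpert θ x]
      refine half_le_lintegral_affinity hφ hf hx₀ (hl θ) (hl θ') (h₀ θ) (h₀ θ') (h₁ θ) (h₁ θ')
        (u := i₁ + k * h) (v := i₁ + (k * h + h)) (d := d) (T := K * h) hε (fun x hx => ?_)
        (hge θ) (hge θ') (fun x => ?_) (by positivity) (fun x hx => ?_) hn hnK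
      · have := mem_Icc_of_comb_update_ne (θ := θ) (k := k) (b := !θ k) (y := (x - i₁) * h⁻¹)
          fun he => hx (by simp only [hlam, hθ', he])
        rw [← div_eq_mul_inv, mem_Icc, le_div_iff₀ hh, div_le_iff₀ hh] at this
        constructor <;> linarith [this.1, this.2]
      · simp only [hlam]
        rw [add_sub_add_left_eq_sub, ← mul_sub, abs_mul, abs_of_nonneg hd]
        refine mul_le_of_le_one_right hd (abs_le.2 ⟨?_, ?_⟩)
        · linarith [comb_nonneg θ ((x - i₁) * h⁻¹), comb_le_one θ' ((x - i₁) * h⁻¹)]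
        · linarith [comb_nonneg θ' ((x - i₁) * h⁻¹), comb_le_one θ ((x - i₁) * h⁻¹)]
      · have := hV x hx (i₁ + k * h) (i₁ + (k * h + h)) (by linarith [hk0 k]) (by linarith)
          (by linarith [hk1 k])
        convert this using 3
        ring
    · have hvol : volume (J k) = ENNReal.ofReal (h / 2) := by
        rw [Real.volume_Icc]
        congr 1
        ring
      rw [← hvol]
      refine le_lintegral_sq_add measurableSet_Icc (hest.comp measurable_prodMk_left)
        (hl θ).measurable fun x hx => ?_
      rw [hlamJ θ k x hx, hlamJ θ' k x hx, hθ', Function.update_self]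
      cases θ k <;> simp

/-- A resolution `m` of order `n ^ (1 / (2 α + 1))`. -/
theorem exists_resolution {α w : ℝ} (hα : 0 < α) (hw : 0 < w) {n : ℕ} (hn : 1 ≤ n) :
    ∃ m : ℕ, 1 ≤ m ∧ n * (w / m) ^ (2 * α + 1) ≤ w ^ (2 * α + 1) ∧
      (w / 2) ^ (2 * α) * (n : ℝ) ^ (-(2 * α) / (2 * α + 1)) ≤ (w / m) ^ (2 * α) := by
  have hn0 : (0 : ℝ) < n := by exact_mod_cast hn
  have hn1 : (1 : ℝ) ≤ n := by exact_mod_cast hn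
  have he : 0 < 2 * α + 1 := by positivity
  set N := (n : ℝ) ^ (1 / (2 * α + 1)) with hN
  have hN1 : 1 ≤ N := Real.one_le_rpow hn1 (by positivity)
  -- Since `N ≥ 1`, rounding up costs at most a factor `2`: the lower bound limits the information,
  -- the upper one keeps `h` large.
  have hmN : N ≤ ⌈N⌉₊ := Nat.le_ceil N
  have hmN2 : (⌈N⌉₊ : ℝ) ≤ 2 * N := by linarith [Nat.ceil_lt_add_one (by linarith : 0 ≤ N)]
  have hm0 : (0 : ℝ) < ⌈N⌉₊ := by linarith
  refine ⟨⌈N⌉₊, Nat.one_le_ceil_iff.2 (by linarith), ?_, ?_⟩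
  · have h1 : (n : ℝ) ≤ (⌈N⌉₊ : ℝ) ^ (2 * α + 1) := by
      calc (n : ℝ) = N ^ (2 * α + 1) := by
            rw [hN, ← Real.rpow_mul hn0.le, one_div_mul_cancel he.ne', Real.rpow_one]
        _ ≤ _ := by gcongr
    rw [Real.div_rpow hw.le hm0.le, mul_div_assoc', div_le_iff₀ (by positivity), mul_comm]
    gcongr
  · have h2 : (n : ℝ) ^ (-(2 * α) / (2 * α + 1)) = N⁻¹ ^ (2 * α) := by
      rw [hN, Real.inv_rpow (by positivity), ← Real.rpow_mul hn0.le, ← Real.rpow_neg hn0.le]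
      congr 1
      ring
    rw [h2, ← Real.mul_rpow (by positivity) (by positivity)]
    gcongr
    rw [div_mul_eq_mul_div, div_le_div_iff₀ two_pos hm0, mul_assoc]
    gcongr
    rw [inv_mul_le_iff₀ (by linarith)]
    linarith

theorem exists_amplitude {α w ε K K' η R : ℝ} (hw : 0 < w) (hε : 0 < ε) (hK : 0 < K)
    (hK' : 0 < K') (hη : 0 < η) (hR : ε < R) :
    ∃ A, 0 < A ∧ A * K' + (ε + A * w ^ α) ≤ R ∧ A * w ^ α ≤ η ∧
      A ^ 2 / (8 * ε) * (K * w ^ (2 * α + 1)) ≤ 1 / 2 := by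
  have hp := Real.rpow_pos_of_pos hw α
  have hp' := Real.rpow_pos_of_pos hw (2 * α + 1)
  have hR' := sub_pos.2 hR
  -- One entry for each requirement: Hölder ball, size `η`, affinity. The entry `1` gives `A² ≤ A`,
  -- which makes the last requirement linear in `A`.
  set A := min (min 1 ((R - ε) / (K' + w ^ α)))
    (min (η / w ^ α) (4 * ε / (K * w ^ (2 * α + 1)))) with hA
  have hA0 : 0 < A := by simp only [hA, lt_min_iff]; refine ⟨⟨?_, ?_⟩, ?_, ?_⟩ <;> positivity
  have h1 : A ≤ 1 := (min_le_left _ _).trans (min_le_left _ _)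
  have h2 : A ≤ (R - ε) / (K' + w ^ α) := (min_le_left _ _).trans (min_le_right _ _)
  have h3 : A ≤ η / w ^ α := (min_le_right _ _).trans (min_le_left _ _)
  have h4 : A ≤ 4 * ε / (K * w ^ (2 * α + 1)) := (min_le_right _ _).trans (min_le_right _ _)
  rw [le_div_iff₀ (by positivity)] at h2 h3 h4
  refine ⟨A, hA0, by linarith, h3, ?_⟩
  rw [div_mul_eq_mul_div, div_le_iff₀ (by positivity)]
  calc A ^ 2 * (K * w ^ (2 * α + 1)) ≤ A * (K * w ^ (2 * α + 1)) := by gcongr; nlinarith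
    _ ≤ _ := by linarith

end LowerBound

end PDMP

end

/-! ### The minimax bound. -/

theorem mainTheorem3
    (φ : ℝ → ℝ → ℝ) (f : ℝ → ℝ) (x₀ κ : ℝ) (m M : ℝ → ℝ)
    (hx₀ : 0 ≤ x₀) (hκ₀ : 0 < κ) (hκ₁ : κ < 1)
    (hφ : PDMP.IsFlow φ x₀) (hf : PDMP.IsJumpMap f κ) (hmM : PDMP.IsBound φ f x₀ m M)
    (i₁ i₂ α M₁ r L a ε b : ℝ)
    (hi₁ : 0 < i₁) (hi : i₁ < i₂) (hα : 0 < α)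
    (hL : 0 < L) (ha : 0 < a) (hε : 0 < ε) (hb : 0 < b)
    (hr : i₂ < r)
    (hr' : PDMP.inv f
      ((-Real.log (1 - κ ^ (b + 1)) / (1 - κ ^ (b + 1))) ^ (1 / (b + 1))) ≤ r)
    (hεM₁ : ε < M₁) (hεL : ε * ∫ u in (f i₁)..(f r), M u < L) :
    ∃ C : ℝ, 0 < C ∧ ∀ n : ℕ, 1 ≤ n →
      ENNReal.ofReal (C * (n : ℝ) ^ (-(2 * α) / (2 * α + 1))) ≤
        ⨅ (est : (Fin (n + 1) → ℝ) → ℝ → ℝ) (_ : Measurable (Function.uncurry est)),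
          ⨆ lam ∈ {lam | PDMP.MemE f m M r L a ε b i₁ lam} ∩
              PDMP.holderBall α (Icc i₁ i₂) M₁,
            PDMP.risk φ f x₀ (Icc i₁ i₂) lam est := by
  obtain ⟨K, hK, hV⟩ := hmM.exists_volume_le hφ hf hx₀ (i₂ := i₂) hi₁
  obtain ⟨K', hK', hball⟩ := PDMP.exists_mem_holderBall hα
  obtain ⟨base, η, hη, hbc, hb₀, hbε, hb₁, hmem⟩ := PDMP.exists_base_rate hf
    hmM.continuousOn_lower hmM.continuousOn_upper hmM.pos
    (fun y hy => (hmM.pos y hy).le.trans (hmM.le y hy)) hi₁ hi hr ha hε hb hεL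
  set w := i₂ - i₁ with hw
  have hw0 : 0 < w := sub_pos.2 hi
  obtain ⟨A, hA, hA1, hA2, hA3⟩ := PDMP.exists_amplitude (α := α) hw0 hε hK hK' hη hεM₁
  -- The hypercube bound is `l * ((A h ^ α)² / 2 * (h / 2) / 8) = w A² h ^ (2α) / 32`, to be halved
  -- because of the factor `2` in Assouad's lemma; `(w / 2) ^ (2α)` comes from the lower bound on `h
  -- ^ (2α)`.
  refine ⟨w * A ^ 2 * (w / 2) ^ (2 * α) / 64, by positivity, fun n hn => ?_⟩
  refine le_iInf₂ fun est hest => ?_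
  obtain ⟨l, hl, hl1, hl2⟩ := PDMP.exists_resolution hα hw0 hn
  have hl0 : (0 : ℝ) < l := by exact_mod_cast hl
  set h := w / l with hh
  have hh0 : 0 < h := by positivity
  have hlh : l * h = w := mul_div_cancel₀ w hl0.ne'
  have hhw : h ≤ w := div_le_self hw0.le (by exact_mod_cast hl)
  have hhα : h ^ α ≤ w ^ α := by gcongr
  have hsq : (h ^ α) ^ 2 = h ^ (2 * α) := by
    rw [← Real.rpow_mul_natCast hh0.le, mul_comm]; norm_cast
  have key := PDMP.minimax_hypercube (m := l) (d := A * h ^ α) hφ hf hx₀ hbc hb₀ hb₁ hh0 hlh hε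
    hbε (by positivity) hK.le hV hn ?_ hest (s := ⨆ lam ∈ {lam | PDMP.MemE f m M r L a ε b i₁ lam} ∩
      PDMP.holderBall α (Icc i₁ i₂) M₁, PDMP.risk φ f x₀ (Icc i₁ i₂) lam est)
    fun θ => le_iSup₂_of_le _ ⟨hmem _ ?_ ?_ ?_ ?_, hball l θ ε A h i₁ i₂ M₁ _ hh0 hA.le hε.le hi
      (fun x hx => by simp only [hbε x hx]) ?_⟩ le_rfl
  · have h8 : (l : ENNReal) * (ENNReal.ofReal ((A * h ^ α) ^ 2 / 2) * ENNReal.ofReal (h / 2) / 8) =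
        ENNReal.ofReal (l * ((A * h ^ α) ^ 2 / 2 * (h / 2) / 8)) := by
      rw [ENNReal.ofReal_mul hl0.le, ENNReal.ofReal_natCast,
        ENNReal.ofReal_div_of_pos (y := 8) (by norm_num), ENNReal.ofReal_mul (by positivity),
        ENNReal.ofReal_ofNat]
    rw [h8] at key
    refine (ENNReal.mul_le_mul_iff_right two_ne_zero ENNReal.ofNat_ne_top).1 (le_trans ?_ key)
    rw [← ENNReal.ofReal_ofNat 2, ← ENNReal.ofReal_mul (by norm_num)]
    refine ENNReal.ofReal_le_ofReal ?_
    calc 2 * (w * A ^ 2 * (w / 2) ^ (2 * α) / 64 * (n : ℝ) ^ (-(2 * α) / (2 * α + 1))) =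
          w * A ^ 2 / 32 * ((w / 2) ^ (2 * α) * (n : ℝ) ^ (-(2 * α) / (2 * α + 1))) := by ring
      _ ≤ w * A ^ 2 / 32 * h ^ (2 * α) := by gcongr
      _ = (l * h) * A ^ 2 / 32 * (h ^ α) ^ 2 := by rw [hlh, hsq]
      _ = _ := by ring
  · calc n * ((A * h ^ α) ^ 2 / (8 * ε) * (K * h)) =
          A ^ 2 / (8 * ε) * (K * (n * ((h ^ α) ^ 2 * h))) := by ring
      _ = A ^ 2 / (8 * ε) * (K * (n * h ^ (2 * α + 1))) := by
        rw [hsq, Real.rpow_add_one hh0.ne']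
      _ ≤ A ^ 2 / (8 * ε) * (K * w ^ (2 * α + 1)) := by gcongr
      _ ≤ _ := hA3
  · exact continuous_const.mul ((PDMP.contDiff_comb θ).continuous.comp (by fun_prop))
  · exact fun x => mul_nonneg (by positivity) (PDMP.comb_nonneg _ _)
  · intro x
    calc A * h ^ α * PDMP.comb θ ((x - i₁) * h⁻¹) ≤ A * h ^ α :=
          mul_le_of_le_one_right (by positivity) (PDMP.comb_le_one _ _)
      _ ≤ A * w ^ α := by gcongr
      _ ≤ η := hA2
  · intro x hx
    rw [PDMP.comb_eq_zero, mul_zero]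
    intro hx'
    rw [← div_eq_mul_inv, mem_Icc, le_div_iff₀ hh0, div_le_iff₀ hh0, hlh] at hx'
    exact hx ⟨by linarith [hx'.1], by linarith [hx'.2]⟩
  · have : A * h ^ α ≤ A * w ^ α := by gcongr
    linarith
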